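/- Let $f,g:S^2\to\mathbb R^3$ be smooth embeddings that are transversal to each other and whose images meet in a single smoothly embedded circle. (The spheres may be given orientations; these play no role in the conclusion.) Then the two spheres cannot be separated along a good family: there is no good family $\Phi_t:S^2\to\mathbb R^3$, $t\in[0,1]$, relative to $g$, with $\Phi_0=f$ and $\Phi_1(S^2)\cap g(S^2)=\emptyset$. Here a *knot* is a smoothly embedded circle in $\mathbb R^3$, and a *link* is a union of finitely many (possibly zero) pairwise disjoint knots. A *good family relative to $g$* is a smooth map $\Phi:[0,1]\times S^2\to\mathbb R^3$, $\Phi_t=\Phi(t,\cdot)$, such that 1. every $\Phi_t$ is an embedding; 2. for every $t\in[0,1]$ the intersection $\Phi_t(S^2)\cap g(S^2)$ is a link; 3. the map $\Phi$ on the three-manifold $[0,1]\times S^2$ is transversal to $g$, that is, whenever $\Phi_t(p)=g(q)$, the vector $\partial_t\Phi(t,p)$ together with the images of $d_p\Phi_t$ and $d_q g$ spans $\mathbb R^3$; 4. there are only finitely many critical times, i.e. $t\in[0,1]$ for which $\Phi_t$ is not transversal to $g$; 5. at a critical time $t$, every point at which $\Phi_t$ and $g$ are not transversal lies on a knot $\gamma$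 along which the configuration is diffeomorphic to the following one: some diffeomorphism from an open neighbourhood of $\gamma$ in $\mathbb R^3$ onto an open neighbourhood of the circle $\{x^2+y^2=1,\ z=0\}$ carries $\gamma$ onto this circle, and the parts of $\Phi_t(S^2)$ and $g(S^2)$ in the first neighbourhood onto the parts in the second of, respectively, the surface $z=r(r-2)+1$, $r=\sqrt{x^2+y^2}$ (the parabola $z=x(x-2)+1$ rotated about the $z$-axis) and the plane $z=0$. -/

import Mathlib

open Set
open scoped Manifold ContDiff

namespace Bubbles

/-- Euclidean three-space. -/
abbrev E3 : Type := EuclideanSpace ℝ (Fin 3)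

/-- The standard two-sphere, with its standard smooth structure. -/
abbrev S2 : Type := Metric.sphere (0 : EuclideanSpace ℝ (Fin 3)) 1

/-- `f : S² → ℝ³` is a smooth (`C^∞`) embedding. -/
def IsSphereEmbedding (f : S2 → E3) : Prop :=
  Manifold.IsSmoothEmbedding (𝓡 2) (𝓡 3) ∞ f

/-- `c : S¹ → ℝ³` is a smooth (`C^∞`) embedding. -/
def IsCircleEmbedding (c : Circle → E3) : Prop :=
  Manifold.IsSmoothEmbedding (𝓡 1) (𝓡 3) ∞ c

/-- A knot: a smoothly embedded circle in `ℝ³`. -/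
def IsKnot (γ : Set E3) : Prop :=
  ∃ c : Circle → E3, IsCircleEmbedding c ∧ γ = range c

/-- A link: the union of finitely many pairwise disjoint knots. The empty link is allowed. -/
def IsLink (L : Set E3) : Prop :=
  ∃ (n : ℕ) (c : Fin n → Circle → E3),
    (∀ i, IsCircleEmbedding (c i)) ∧
    (∀ i j, i ≠ j → Disjoint (range (c i)) (range (c j))) ∧
    L = ⋃ i, range (c i)

/-- The image in `ℝ³` of the differential of `f` at `p`. -/
noncomputable def tangentImage (f : S2 → E3) (p : S2) : Submodule ℝ E3 :=
  (mvfderiv (𝓡 2) f p).range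

/-- `f` and `g` are transversal: wherever their images meet, their tangent planes span `ℝ³`. -/
def Transversal (f g : S2 → E3) : Prop :=
  ∀ p q : S2, f p = g q → tangentImage f p ⊔ tangentImage g q = ⊤

/-- The time derivative at `(t, p)` of a family defined for times in `[0,1]` (one-sided at the
end points). -/
noncomputable def velocity (Φ : ℝ → S2 → E3) (t : ℝ) (p : S2) : E3 :=
  derivWithin (fun s => Φ s p) (Icc 0 1) t

/-- The family `Φ`, as a map `[0,1] × S² → ℝ³` of a three-manifold, is transversal to `g`. The image
of its differential at `(t, p)` is spanned by the velocity and by the image of the differential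
of `Φ t`. -/
def FamilyTransversal (Φ : ℝ → S2 → E3) (g : S2 → E3) : Prop :=
  ∀ t ∈ Icc (0 : ℝ) 1, ∀ p q : S2, Φ t p = g q →
    Submodule.span ℝ {velocity Φ t p} ⊔ tangentImage (Φ t) p ⊔ tangentImage g q = ⊤

/-- The distance to the `z`-axis. -/
noncomputable def axisDist (x : E3) : ℝ := √(x 0 ^ 2 + x 1 ^ 2)

/-- The parabola `z = x (x - 2) + 1`, rotated about the `z`-axis. -/
def modelParabola : Set E3 := {x | x 2 = axisDist x * (axisDist x - 2) + 1}

/-- The `xy`-plane. -/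
def modelPlane : Set E3 := {x | x 2 = 0}

/-- The unit circle in the `xy`-plane. -/
def modelCircle : Set E3 := {x | x 0 ^ 2 + x 1 ^ 2 = 1 ∧ x 2 = 0}

/-- Along `γ` the pair of surfaces `A`, `B` is diffeomorphic to the rotated parabola and the plane
along the unit circle: a diffeomorphism from an open neighbourhood of `γ` onto an open
neighbourhood of the unit circle carries the parts of `A`, `B`, `γ` in the first
neighbourhood onto the parts of the three model sets in the second. -/
def HasModelTangency (A B γ : Set E3) : Prop :=
  ∃ Ψ : OpenPartialHomeomorph E3 E3,
    ContDiffOn ℝ ∞ Ψ Ψ.source ∧ ContDiffOn ℝ ∞ Ψ.symm Ψ.target ∧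
    γ ⊆ Ψ.source ∧ modelCircle ⊆ Ψ.target ∧
    Ψ '' γ = modelCircle ∧
    Ψ '' (A ∩ Ψ.source) = modelParabola ∩ Ψ.target ∧
    Ψ '' (B ∩ Ψ.source) = modelPlane ∩ Ψ.target

/-- A good family of embeddings `Φ t : S² → ℝ³`, `t ∈ [0,1]`, relative to the fixed embedding `g`.
Only the values of `Φ` at times in `[0,1]` matter. -/
structure IsGoodFamily (g : S2 → E3) (Φ : ℝ → S2 → E3) : Prop where
  /-- The family is smooth on `[0,1] × S²`. -/
  smooth : ContMDiffOn (𝓘(ℝ, ℝ).prod (𝓡 2)) (𝓡 3) ∞ (fun x : ℝ × S2 => Φ x.1 x.2)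
    (Icc (0 : ℝ) 1 ×ˢ univ)
  embedding : ∀ t ∈ Icc (0 : ℝ) 1, IsSphereEmbedding (Φ t)
  link : ∀ t ∈ Icc (0 : ℝ) 1, IsLink (range (Φ t) ∩ range g)
  transversal : FamilyTransversal Φ g
  /-- There are finitely many critical times. -/
  finite_critical : {t ∈ Icc (0 : ℝ) 1 | ¬ Transversal (Φ t) g}.Finite
  /-- Every point of non-transversality lies on a knot of model tangency. -/
  model : ∀ t ∈ Icc (0 : ℝ) 1, ∀ p q : S2, Φ t p = g q →
    tangentImage (Φ t) p ⊔ tangentImage g q ≠ ⊤ →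
    ∃ γ : Set E3, IsKnot γ ∧ Φ t p ∈ γ ∧ HasModelTangency (range (Φ t)) (range g) γ

end Bubbles

/-!
The parity of the number of circles along which `Φ t` meets `g` transversally does not depend on
`t`. Near a circle of transversal intersection the intersection stays a single circle. Near a
tangency circle, `g` is the zero set of a function `h` whose restriction to `Φ t` is `ρ ^ 2`, where
`ρ` changes sign across the circle; transversality of the family forces `∂ₜ h ≠ 0` there. Hence on
one side of the critical time `h` is positive and the intersection is empty, and on the other side
`h` has exactly one zero with `ρ > 0` and one with `ρ < 0` on each line crossing the circle, so the
intersection consists of two circles. The parity is `1` for a single circle and `0` for disjoint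
spheres.
-/

namespace Bubbles

open Filter Topology

section Parity

variable {X : Type*} [TopologicalSpace X]

/-- `K` has finitely many connected components, and their number is `a` modulo two. -/
def HasComponentParity (K : Set X) (a : ZMod 2) : Prop :=
  Finite (ConnectedComponents K) ∧ (Nat.card (ConnectedComponents K) : ZMod 2) = a

lemma HasComponentParity.unique {K : Set X} {a b : ZMod 2} (ha : HasComponentParity K a)
    (hb : HasComponentParity K b) : a = b :=
  ha.2.symm.trans hb.2

lemma hasComponentParity_empty : HasComponentParity (∅ : Set X) 0 := by
  have : IsEmpty (ConnectedComponents (∅ : Set X)) :=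
    ConnectedComponents.isEmpty_iff_isEmpty.2 inferInstance
  exact ⟨inferInstance, by simp⟩

lemma hasComponentParity_one_of_isConnected {K : Set X} (hK : IsConnected K) :
    HasComponentParity K 1 := by
  have : ConnectedSpace K := isConnected_iff_connectedSpace.1 hK
  exact ⟨inferInstance, by simp⟩

/-- The bijection between connected components induced by a homeomorphism. -/
noncomputable def connectedComponentsEquiv {Y : Type*} [TopologicalSpace Y] (e : X ≃ₜ Y) :
    ConnectedComponents X ≃ ConnectedComponents Y :=
  (e.isQuotientMap.isCoinducing.connectedComponentsHomeomorph fun y => by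
    rw [← e.image_symm, image_singleton]
    exact isConnected_singleton).toEquiv

lemma HasComponentParity.iUnion {ι : Type*} [Fintype ι] {K : Set X} {U : ι → Set X} {a : ι → ZMod 2}
    (hU : ∀ i, IsOpen (U i)) (hd : Pairwise (Function.onFun Disjoint U)) (hK : K ⊆ ⋃ i, U i)
    (h : ∀ i, HasComponentParity (K ∩ U i) (a i)) : HasComponentParity K (∑ i, a i) := by
  let V : ι → Set K := fun i => (↑) ⁻¹' U i
  have hVd : Pairwise (Function.onFun Disjoint V) := fun i j hij => (hd hij).preimage _
  have hVU : ⋃ i, V i = univ := by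
    rw [← preimage_iUnion, eq_univ_iff_forall]
    exact fun x => hK x.2
  have hV : ∀ i, IsClopen (V i) := by
    have hVo : ∀ i, IsOpen (V i) := fun i => (hU i).preimage continuous_subtype_val
    refine fun i => isClopen_of_disjoint_cover_open (b := ⋃ j ≠ i, V j) (fun x _ => ?_) (hVo i)
      (isOpen_biUnion fun j _ => hVo j) (disjoint_iUnion₂_right.2 fun j hj => hVd hj.symm)
    obtain ⟨j, hj⟩ := iUnion_eq_univ_iff.1 hVU x
    obtain rfl | hji := eq_or_ne j i
    · exact Or.inl hj
    · exact Or.inr (mem_biUnion hji hj)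
  let e := ConnectedComponents.equivOfIsClopen hV hVd hVU
  let φ : ∀ i, ConnectedComponents (V i) ≃ ConnectedComponents ↥(K ∩ U i) := fun i =>
    connectedComponentsEquiv <| (IsEmbedding.subtypeVal.homeomorphImage (V i)).trans
      (.setCongr (Subtype.image_preimage_coe K (U i)))
  have : ∀ i, Finite (ConnectedComponents (V i)) := fun i =>
    have := (h i).1
    .of_equiv _ (φ i).symm
  refine ⟨.of_equiv _ e.symm, ?_⟩
  rw [Nat.card_congr e, Nat.card_sigma, Nat.cast_sum]
  exact Finset.sum_congr rfl fun i _ => by rw [Nat.card_congr (φ i), (h i).2]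

lemma hasComponentParity_zero_of_two {K P Q : Set X} (hP : IsOpen P) (hQ : IsOpen Q)
    (hPQ : Disjoint P Q) (hK : K ⊆ P ∪ Q) (hKP : IsConnected (K ∩ P)) (hKQ : IsConnected (K ∩ Q)) :
    HasComponentParity K 0 := by
  have := HasComponentParity.iUnion (K := K) (U := fun b : Bool => cond b P Q) (a := fun _ => 1)
    (by simp [hP, hQ]) (by simpa [Pairwise] using ⟨hPQ.symm, hPQ⟩)
    (by simpa [union_eq_iUnion] using hK)
    (by simpa using ⟨hasComponentParity_one_of_isConnected hKQ,
      hasComponentParity_one_of_isConnected hKP⟩)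
  simpa [show (2 : ZMod 2) = 0 from rfl] using this

end Parity

section EventuallyConnected

variable {X S : Type*} [TopologicalSpace X]

/-- The sets `K s` are connected near `p` in the limit along `l`, in arbitrarily small
neighbourhoods of `p`. -/
def EventuallyConnectedAt (l : Filter S) (K : S → Set X) (p : X) : Prop :=
  ∀ W ∈ 𝓝 p, ∃ V ⊆ W, IsOpen V ∧ p ∈ V ∧ ∀ᶠ s in l, IsConnected (K s ∩ V)

lemma isConnected_iUnion_of_cover {ι : Type*} {C : Set X} {V A : ι → Set X}
    (hC : IsConnected C) (hV : ∀ i, IsOpen (V i)) (hCV : C ⊆ ⋃ i, V i)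
    (hne : ∀ i, (C ∩ V i).Nonempty) (hA : ∀ i, IsConnected (A i))
    (hAV : ∀ i j, (C ∩ (V i ∩ V j)).Nonempty → (A i ∩ A j).Nonempty) : IsConnected (⋃ i, A i) := by
  have : ConnectedSpace C := isConnected_iff_connectedSpace.1 hC
  let V' : ι → Set C := fun i => (↑) ⁻¹' V i
  have hV' : ⋃ i, V' i = univ := by
    rw [← preimage_iUnion, eq_univ_iff_forall]
    exact fun x => hCV x.2
  have : Nonempty ι := by
    obtain ⟨x, hx⟩ := hC.nonempty
    obtain ⟨i, -⟩ := mem_iUnion.1 (hCV hx)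
    exact ⟨i⟩
  refine IsConnected.iUnion_of_reflTransGen hA fun i j => ?_
  have hchain : Relation.TransGen (fun i j => (V' i ∩ V' j).Nonempty) i j :=
    IsPreconnected.transGen_of_iUnion (by rw [hV']; exact isPreconnected_univ)
      (fun i => (hV i).preimage continuous_subtype_val) i j
      (let ⟨x, hxC, hx⟩ := hne i; ⟨⟨x, hxC⟩, hx⟩) (let ⟨x, hxC, hx⟩ := hne j; ⟨⟨x, hxC⟩, hx⟩)
  exact Relation.ReflTransGen.mono (fun i j ⟨x, hx⟩ => hAV i j ⟨x, x.2, hx⟩) _ _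
    hchain.to_reflTransGen

lemma eventually_isConnected_inter {l : Filter S} {K : S → Set X} {C W : Set X}
    (hCcomp : IsCompact C) (hCconn : IsConnected C) (hW : IsOpen W) (hCW : C ⊆ W)
    (hK : ∀ p ∈ C, EventuallyConnectedAt l K p)
    (hlim : ∀ U, IsOpen U → C ⊆ U → ∀ᶠ s in l, K s ∩ W ⊆ U) :
    ∀ᶠ s in l, IsConnected (K s ∩ W) := by
  choose! V hVW hVo hpV hV using fun p hp => hK p hp W (hW.mem_nhds (hCW hp))
  obtain ⟨t, htC, hCt⟩ := hCcomp.elim_nhds_subcover V fun p hp => (hVo p hp).mem_nhds (hpV p hp)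
  have hCU : C ⊆ ⋃ p : t, V p := fun x hx =>
    let ⟨p, hpt, hxp⟩ := mem_iUnion₂.1 (hCt hx)
    mem_iUnion.2 ⟨⟨p, hpt⟩, hxp⟩
  have hoverlap : ∀ p q : t, (C ∩ (V p ∩ V q)).Nonempty →
      ∀ᶠ s in l, (K s ∩ (V p ∩ V q)).Nonempty := by
    rintro p q ⟨x, hxC, hx⟩
    obtain ⟨V', hV', -, -, hconn⟩ := hK x hxC (V p ∩ V q)
      (((hVo p (htC p p.2)).inter (hVo q (htC q q.2))).mem_nhds hx)
    exact hconn.mono fun s hs => hs.nonempty.mono (inter_subset_inter_right _ hV')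
  filter_upwards [hlim _ (isOpen_iUnion fun p : t => hVo p (htC p p.2)) hCU,
    eventually_all.2 fun p : t => hV p (htC p p.2),
    eventually_all.2 fun p : t => eventually_all.2 fun q : t =>
      eventually_imp_distrib_left.2 (hoverlap p q)] with s hsub hconn hmeet
  have hpieces : K s ∩ W = ⋃ p : t, K s ∩ V p := by
    rw [← inter_iUnion]
    exact Subset.antisymm (subset_inter inter_subset_left hsub)
      (inter_subset_inter_right _ (iUnion_subset fun p => hVW p (htC p p.2)))
  rw [hpieces]
  exact isConnected_iUnion_of_cover hCconn (fun p => hVo p (htC p p.2)) hCU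
    (fun p => ⟨p, htC p p.2, hpV p (htC p p.2)⟩) hconn fun p q hpq => by
      rw [← inter_inter_distrib_left]
      exact hmeet p q hpq

lemma EventuallyConnectedAt.of_openPartialHomeomorph {Y : Type*} [TopologicalSpace Y]
    {l : Filter S} {K : S → Set Y} {K' : S → Set X} (e : OpenPartialHomeomorph X Y) {p : X}
    (hp : p ∈ e.source) (hK : EventuallyConnectedAt l K (e p))
    (h : ∀ᶠ z in l ×ˢ 𝓝 p, z.2 ∈ K' z.1 ↔ e z.2 ∈ K z.1) : EventuallyConnectedAt l K' p := by
  intro W hW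
  obtain ⟨A, hA, B, hB, hAB⟩ := eventually_prod_iff.1 h
  obtain ⟨V, hVsub, hV, hpV, hconn⟩ := hK (e.target ∩ e.symm ⁻¹' (W ∩ {x | B x})) (by
    refine inter_mem (e.open_target.mem_nhds (e.map_source hp)) ?_
    exact e.symm.continuousAt (e.map_source hp) |>.preimage_mem_nhds
      (by rw [e.left_inv hp]; exact inter_mem hW hB))
  have hmem : ∀ x ∈ e.source ∩ e ⁻¹' V, x ∈ W ∧ B x := fun x hx => by
    simpa only [mem_inter_iff, mem_preimage, mem_ofPred_eq, e.left_inv hx.1] using (hVsub hx.2).2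
  refine ⟨e.source ∩ e ⁻¹' V, fun x hx => (hmem x hx).1, e.isOpen_inter_preimage hV, ⟨hp, hpV⟩, ?_⟩
  filter_upwards [hconn, hA] with s hs hsA
  have himage : K' s ∩ (e.source ∩ e ⁻¹' V) = e.symm '' (K s ∩ V) := by
    ext x
    constructor
    · rintro ⟨hx, hxe, hxV⟩
      exact ⟨e x, ⟨(hAB hsA (hmem x ⟨hxe, hxV⟩).2).1 hx, hxV⟩, e.left_inv hxe⟩
    · rintro ⟨y, ⟨hyK, hyV⟩, rfl⟩
      have hy := hVsub hyV
      refine ⟨(hAB hsA hy.2.2).2 ?_, e.map_target hy.1, ?_⟩ <;>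
        simpa only [mem_preimage, e.right_inv hy.1]
  rw [himage]
  exact hs.image _ (e.continuousOn_symm.mono fun y hy => (hVsub hy.2).1)

lemma EventuallyConnectedAt.congr {l : Filter S} {K K' : S → Set X} {p : X}
    (hK : EventuallyConnectedAt l K p) (h : ∀ᶠ z in l ×ˢ 𝓝 p, z.2 ∈ K' z.1 ↔ z.2 ∈ K z.1) :
    EventuallyConnectedAt l K' p :=
  .of_openPartialHomeomorph (.refl X) (mem_univ p) hK h

end EventuallyConnected

section Concentration

variable {S X : Type*} [TopologicalSpace X] {l : Filter S} {C : Set X}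

lemma eventually_forall_mem_inter {K : S → Set X} {W : Set X} (hC : IsCompact C)
    (hlim : ∀ U, IsOpen U → C ⊆ U → ∀ᶠ s in l, K s ∩ W ⊆ U) {Q : S × X → Prop}
    (hQ : ∀ p ∈ C, ∀ᶠ z in l ×ˢ 𝓝 p, Q z) : ∀ᶠ s in l, ∀ x ∈ K s ∩ W, Q (s, x) := by
  obtain ⟨A, hA, B, hB, hAB⟩ := mem_prod_iff.1 (hC.mem_prod_nhdsSet_of_forall hQ)
  obtain ⟨U, hU, hCU, hUB⟩ := mem_nhdsSet_iff_exists.1 hB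
  filter_upwards [hA, hlim U hU hCU] with s hs hsU x hx
  exact hAB ⟨hs, hUB (hsU hx)⟩

lemma forall_eventually_or_of_isPreconnected [l.NeBot] (hC : IsPreconnected C)
    {Q R : S × X → Prop} (hQR : ∀ p ∈ C, ∀ s, ¬ (Q (s, p) ∧ R (s, p)))
    (h : ∀ p ∈ C, (∀ᶠ z in l ×ˢ 𝓝 p, Q z) ∨ ∀ᶠ z in l ×ˢ 𝓝 p, R z) :
    (∀ p ∈ C, ∀ᶠ z in l ×ˢ 𝓝 p, Q z) ∨ ∀ p ∈ C, ∀ᶠ z in l ×ˢ 𝓝 p, R z := by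
  have hopen (T : S × X → Prop) : IsOpen {p | ∀ᶠ z in l ×ˢ 𝓝 p, T z} := by
    refine isOpen_iff_mem_nhds.2 fun p hp => ?_
    obtain ⟨A, hA, B, hB, hAB⟩ := eventually_prod_iff.1 hp
    filter_upwards [hB.eventually_nhds] with q hq
    exact eventually_prod_iff.2 ⟨A, hA, B, hq, hAB⟩
  refine isPreconnected_iff_subset_of_disjoint.1 hC _ _ (hopen Q) (hopen R) h ?_
  refine eq_empty_of_forall_notMem fun p ⟨hpC, hpQ, hpR⟩ => ?_
  have hp : Tendsto (fun s => (s, p)) l (l ×ˢ 𝓝 p) := tendsto_id.prodMk tendsto_const_nhds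
  obtain ⟨s, hs⟩ := ((hp.eventually hpQ).and (hp.eventually hpR)).exists
  exact hQR p hpC s hs

lemma eventually_preimage_inter_subset [CompactSpace X] {T Y : Type*} [TopologicalSpace T]
    [TopologicalSpace Y] {Φ : T → X → Y} (hΦ : Continuous fun z : T × X => Φ z.1 z.2) {A : Set Y}
    (hA : IsClosed A) {t : T} {U W : Set X} (hU : IsOpen U) (h : Φ t ⁻¹' A ∩ closure W ⊆ U) :
    ∀ᶠ s in 𝓝 t, Φ s ⁻¹' A ∩ W ⊆ U := by
  have hD : IsCompact (closure W \ U) := (isClosed_closure.sdiff hU).isCompact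
  filter_upwards [hD.eventually_forall_of_forall_eventually (x₀ := t)
    (P := fun s x => Φ s x ∈ Aᶜ) fun x hx => hΦ.continuousAt.eventually
      (hA.isOpen_compl.mem_nhds fun hxA => hx.2 (h ⟨hxA, hx.1⟩))] with s hs x hx
  by_contra hxU
  exact hs x ⟨subset_closure hx.2, hxU⟩ hx.1

lemma hasComponentParity_zero_of_pos_neg {K : Set X} {ρ : X → ℝ}
    (hρ : ∀ x ∈ K, ContinuousAt ρ x ∧ ρ x ≠ 0) (hpos : IsConnected (K ∩ {x | 0 < ρ x}))
    (hneg : IsConnected (K ∩ {x | ρ x < 0})) : HasComponentParity K 0 := by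
  have hint (I : Set ℝ) (hI : IsOpen I) : K ∩ interior (ρ ⁻¹' I) = K ∩ ρ ⁻¹' I :=
    Subset.antisymm (inter_subset_inter_right _ interior_subset) fun x hx =>
      ⟨hx.1, mem_interior_iff_mem_nhds.2 ((hρ x hx.1).1 (hI.mem_nhds hx.2))⟩
  have hsplit : K ∩ ρ ⁻¹' Ioi 0 ∪ K ∩ ρ ⁻¹' Iio 0 = K := by
    refine union_subset inter_subset_left inter_subset_left |>.antisymm fun x hx => ?_
    exact (hρ x hx).2.lt_or_gt.symm.imp (⟨hx, ·⟩) (⟨hx, ·⟩)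
  refine hasComponentParity_zero_of_two isOpen_interior isOpen_interior
    (((Ioi_disjoint_Iio_same (a := (0 : ℝ))).preimage ρ).mono interior_subset interior_subset) ?_
    ((hint _ isOpen_Ioi).symm ▸ hpos) ((hint _ isOpen_Iio).symm ▸ hneg)
  rw [← inter_eq_left, inter_union_distrib_left, hint _ isOpen_Ioi, hint _ isOpen_Iio, hsplit]

end Concentration

section Separation

variable {X ι : Type*} [TopologicalSpace X] [NormalSpace X] {C : ι → Set X}

lemma exists_isOpen_inter_closure_subset [Finite ι] (hC : ∀ i, IsClosed (C i))
    (hd : Pairwise (Function.onFun Disjoint C)) :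
    ∃ W : ι → Set X, (∀ i, IsOpen (W i)) ∧ (∀ i, C i ⊆ W i) ∧
      Pairwise (Function.onFun Disjoint W) ∧ ∀ i, (⋃ j, C j) ∩ closure (W i) ⊆ C i := by
  have hnhds : Pairwise (Function.onFun Disjoint fun i => 𝓝ˢ (C i)) := fun i j hij =>
    separatedNhds_iff_disjoint.1 (normal_separation (hC i) (hC j) (hd hij))
  obtain ⟨W, hW, hWd⟩ := hnhds.exists_mem_filter_basis_of_disjoint fun i => hasBasis_nhdsSet (C i)
  refine ⟨W, fun i => (hW i).1, fun i => (hW i).2, hWd, fun i => ?_⟩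
  rintro x ⟨hx, hxW⟩
  obtain ⟨j, hj⟩ := mem_iUnion.1 hx
  obtain rfl | hij := eq_or_ne i j
  · exact hj
  · exact (((hWd hij).closure_left (hW j).1).notMem_of_mem_left hxW ((hW j).2 hj)).elim

lemma hasComponentParity_iUnion_of_isConnected [Fintype ι] (hC : ∀ i, IsClosed (C i))
    (hd : Pairwise (Function.onFun Disjoint C)) (hconn : ∀ i, IsConnected (C i)) :
    HasComponentParity (⋃ i, C i) (Fintype.card ι) := by
  obtain ⟨W, hW, hCW, hWd, hWC⟩ := exists_isOpen_inter_closure_subset hC hd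
  have hinter (i : ι) : (⋃ j, C j) ∩ W i = C i :=
    ((inter_subset_inter_right _ subset_closure).trans (hWC i)).antisymm
      (subset_inter (subset_iUnion C i) (hCW i))
  simpa using HasComponentParity.iUnion (a := fun _ => 1) hW hWd (iUnion_mono hCW) fun i =>
    (hinter i).symm ▸ hasComponentParity_one_of_isConnected (hconn i)

end Separation

section Crossing

open SignType (sign)

/-- On `[a, b]` the function `w` changes sign exactly once, from negative to positive, in the
interior. -/
def CrossesUp (w : ℝ → ℝ) (a b : ℝ) : Prop :=
  ∃ r ∈ Ioo a b, ∀ x ∈ Icc a b, sign (w x) = sign (x - r)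

lemma sign_eq_sign_sub {w x r : ℝ} (hlt : x < r → w < 0) (heq : x = r → w = 0)
    (hgt : r < x → 0 < w) : sign w = sign (x - r) := by
  rcases lt_trichotomy x r with h | h | h
  · rw [sign_neg (hlt h), sign_neg (sub_neg.2 h)]
  · rw [heq h, sub_eq_zero.2 h]
  · rw [sign_pos (hgt h), sign_pos (sub_pos.2 h)]

lemma crossesUp_of_strictMonoOn {w : ℝ → ℝ} {a b : ℝ} (hab : a ≤ b)
    (hw : ContinuousOn w (Icc a b)) (hmono : StrictMonoOn w (Icc a b)) (ha : w a < 0)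
    (hb : 0 < w b) : CrossesUp w a b := by
  obtain ⟨r, hr, hwr⟩ := intermediate_value_Ioo hab hw ⟨ha, hb⟩
  have hr' := Ioo_subset_Icc_self hr
  exact ⟨r, hr, fun x hx => sign_eq_sign_sub (fun h => hwr ▸ hmono hx hr' h) (fun h => h ▸ hwr)
    fun h => hwr ▸ hmono hr' hx h⟩

lemma crossesUp_of_convexOn {w : ℝ → ℝ} {a b : ℝ} (hab : a ≤ b)
    (hw : ContinuousOn w (Icc a b)) (hconv : ConvexOn ℝ (Icc a b) w) (ha : w a < 0)
    (hb : 0 < w b) : CrossesUp w a b := by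
  obtain ⟨r, hr, hwr⟩ := intermediate_value_Ioo hab hw ⟨ha, hb⟩
  have ha' : a ∈ Icc a b := left_mem_Icc.2 hab
  refine ⟨r, hr, fun x hx => sign_eq_sign_sub (fun h => ?_) (fun h => h ▸ hwr) fun h => ?_⟩
  · rcases hx.1.eq_or_lt with rfl | hax
    · exact ha
    have hsec := hconv.secant_mono_aux1 ha' (Ioo_subset_Icc_self hr) hax h
    rw [hwr, mul_zero, add_zero] at hsec
    exact neg_of_mul_neg_right (hsec.trans_lt (mul_neg_of_pos_of_neg (sub_pos.2 h) ha))
      (sub_pos.2 (hax.trans h)).le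
  · have hsec := hconv.secant_mono_aux1 ha' hx hr.1 h
    rw [hwr, mul_zero] at hsec
    have hneg := mul_neg_of_pos_of_neg (sub_pos.2 h) ha
    exact pos_of_mul_pos_right (by linarith : 0 < (r - a) * w x) (sub_pos.2 hr.1).le

lemma sign_min_of_pos {p q : ℝ} (hp : 0 < p) : sign (min p q) = sign q := by
  rcases lt_trichotomy q 0 with hq | rfl | hq
  · rw [sign_neg hq, sign_neg (min_lt_of_right_lt hq)]
  · rw [min_eq_right hp.le]
  · rw [sign_pos hq, sign_pos (lt_min hp hq)]

lemma crossesUp_min {ρ w : ℝ → ℝ} {a b : ℝ} (hab : a ≤ b) (hρ : ContinuousOn ρ (Icc a b))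
    (hρmono : StrictMonoOn ρ (Icc a b)) (hw : ContinuousOn w (Icc a b))
    (hconv : ConvexOn ℝ (Icc a b) w) (hneg : ∀ x ∈ Icc a b, ρ x = 0 → w x < 0)
    (ha : min (ρ a) (w a) < 0) (hb : 0 < min (ρ b) (w b)) :
    CrossesUp (fun x => min (ρ x) (w x)) a b := by
  rw [lt_min_iff] at hb
  obtain ⟨c, hc, hwc, hρc, hlt⟩ : ∃ c ∈ Icc a b, w c < 0 ∧ 0 ≤ ρ c ∧ ∀ x ∈ Ico a c, ρ x < 0 := by
    rcases lt_or_ge (ρ a) 0 with hρa | hρa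
    · obtain ⟨c, hc, hρc⟩ := intermediate_value_Icc hab hρ ⟨hρa.le, hb.1.le⟩
      exact ⟨c, hc, hneg c hc hρc, hρc.ge, fun x hx =>
        hρc ▸ hρmono ⟨hx.1, hx.2.le.trans hc.2⟩ hc hx.2⟩
    · refine ⟨a, left_mem_Icc.2 hab, ?_, hρa, by simp⟩
      exact (min_lt_iff.1 ha).resolve_left hρa.not_gt
  have hsub : Icc c b ⊆ Icc a b := Icc_subset_Icc_left hc.1
  obtain ⟨r, hr, hsign⟩ := crossesUp_of_convexOn hc.2 (hw.mono hsub)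
    (hconv.subset hsub (convex_Icc c b)) hwc hb.2
  refine ⟨r, ⟨hc.1.trans_lt hr.1, hr.2⟩, fun x hx => ?_⟩
  rcases lt_trichotomy x c with hxc | rfl | hcx
  · rw [sign_neg (min_lt_of_left_lt (hlt x ⟨hx.1, hxc⟩)), sign_neg (sub_neg.2 (hxc.trans hr.1))]
  · rw [sign_neg (min_lt_of_right_lt hwc), sign_neg (sub_neg.2 hr.1)]
  · rw [sign_min_of_pos (hρc.trans_lt (hρmono hc hx hcx)), hsign x ⟨hcx.le, hx.2⟩]

lemma isConnected_zeros_of_crossesUp {Y : Type*} [TopologicalSpace Y] {a b : ℝ} {B : Set Y}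
    {w : ℝ × Y → ℝ} (hB : IsConnected B) (hw : ContinuousOn w (Icc a b ×ˢ B))
    (hcross : ∀ y ∈ B, CrossesUp (fun x => w (x, y)) a b) :
    IsConnected ({z | w z = 0} ∩ Ioo a b ×ˢ B) := by
  choose! r hr hsign using hcross
  have hslice : ∀ x ∈ Icc a b, ContinuousOn (fun y => w (x, y)) B := fun x hx =>
    hw.comp (by fun_prop) fun y hy => ⟨hx, hy⟩
  have hrcont : ContinuousOn r B := by
    intro y hy
    refine tendsto_order.2 ⟨fun c hc => ?_, fun c hc => ?_⟩
    · obtain ⟨x, hcx, hxr⟩ := exists_between (max_lt hc (hr y hy).1)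
      have hx : x ∈ Icc a b := ⟨((le_max_right _ _).trans_lt hcx).le, (hxr.trans (hr y hy).2).le⟩
      have hwx : w (x, y) < 0 := by
        rw [← sign_eq_neg_one_iff, hsign y hy x hx, sign_eq_neg_one_iff, sub_neg]
        exact hxr
      filter_upwards [(hslice x hx y hy).eventually (gt_mem_nhds hwx), self_mem_nhdsWithin]
        with y' hwx' hy'
      rw [← sign_eq_neg_one_iff, hsign y' hy' x hx, sign_eq_neg_one_iff, sub_neg] at hwx'
      exact ((le_max_left _ _).trans_lt hcx).trans hwx'
    · obtain ⟨x, hrx, hxc⟩ := exists_between (lt_min hc (hr y hy).2)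
      have hx : x ∈ Icc a b := ⟨((hr y hy).1.trans hrx).le, (hxc.trans_le (min_le_right _ _)).le⟩
      have hwx : 0 < w (x, y) := by
        rw [← sign_eq_one_iff, hsign y hy x hx, sign_eq_one_iff, sub_pos]
        exact hrx
      filter_upwards [(hslice x hx y hy).eventually (lt_mem_nhds hwx), self_mem_nhdsWithin]
        with y' hwx' hy'
      rw [← sign_eq_one_iff, hsign y' hy' x hx, sign_eq_one_iff, sub_pos] at hwx'
      exact hwx'.trans (hxc.trans_le (min_le_left _ _))
  have hgraph : {z | w z = 0} ∩ Ioo a b ×ˢ B = (fun y => (r y, y)) '' B := by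
    ext ⟨x, y⟩
    simp only [mem_inter_iff, mem_ofPred_eq, mem_prod, mem_image, Prod.mk.injEq]
    constructor
    · rintro ⟨h0, hx, hy⟩
      rw [← sign_eq_zero_iff, hsign y hy x (Ioo_subset_Icc_self hx), sign_eq_zero_iff,
        sub_eq_zero] at h0
      exact ⟨y, hy, h0.symm, rfl⟩
    · rintro ⟨y, hy, rfl, rfl⟩
      refine ⟨?_, hr y hy, hy⟩
      rw [← sign_eq_zero_iff, hsign y hy _ (Ioo_subset_Icc_self (hr y hy)), sub_self, sign_zero]
  rw [hgraph]
  exact hB.image _ (hrcont.prodMk continuousOn_id)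

lemma eventuallyConnectedAt_zeros_of_crossesUp {S Y : Type*} [TopologicalSpace Y]
    [LocallyConnectedSpace Y] {l : Filter S} {w : S → ℝ × Y → ℝ} {x₀ : ℝ} {y₀ : Y}
    {N : Set (ℝ × Y)} (hN : N ∈ 𝓝 (x₀, y₀))
    (hcont : ∀ᶠ s in l, ContinuousOn (w s) N)
    (hcross : ∀ᶠ s in l, ∀ a b y, a < b → (∀ x ∈ Icc a b, (x, y) ∈ N) → w s (a, y) < 0 →
      0 < w s (b, y) → CrossesUp (fun x => w s (x, y)) a b)
    (hneg : ∀ᶠ x in 𝓝[<] x₀, ∀ᶠ z in l ×ˢ 𝓝 y₀, w z.1 (x, z.2) < 0)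
    (hpos : ∀ᶠ x in 𝓝[>] x₀, ∀ᶠ z in l ×ˢ 𝓝 y₀, 0 < w z.1 (x, z.2)) :
    EventuallyConnectedAt l (fun s => {z | w s z = 0}) (x₀, y₀) := by
  intro W hW
  obtain ⟨A, hA, B, hB, hAB⟩ := mem_nhds_prod_iff.1 (inter_mem hN hW)
  obtain ⟨c, d, hx₀, hcd⟩ := mem_nhds_iff_exists_Ioo_subset.1 hA
  obtain ⟨a, haneg, hca, hax⟩ := (hneg.and (Ioo_mem_nhdsLT hx₀.1)).exists
  obtain ⟨b, hbpos, hxb, hbd⟩ := (hpos.and (Ioo_mem_nhdsGT hx₀.2)).exists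
  obtain ⟨P, hP, Q, hQ, hPQ⟩ := eventually_prod_iff.1 (haneg.and hbpos)
  obtain ⟨D, ⟨hDo, hyD, hDconn⟩, hDsub⟩ :=
    (LocallyConnectedSpace.open_connected_basis y₀).mem_iff.1 (inter_mem hB hQ)
  have hbox : Icc a b ×ˢ D ⊆ N ∩ W := fun z hz =>
    hAB ⟨hcd ⟨hca.trans_le hz.1.1, hz.1.2.trans_lt hbd⟩, (hDsub hz.2).1⟩
  refine ⟨Ioo a b ×ˢ D, fun z hz => (hbox ⟨Ioo_subset_Icc_self hz.1, hz.2⟩).2,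
    isOpen_Ioo.prod hDo, ⟨⟨hax, hxb⟩, hyD⟩, ?_⟩
  filter_upwards [hcont, hcross, hP] with s hs hcs hPs
  refine isConnected_zeros_of_crossesUp hDconn (hs.mono fun z hz => (hbox hz).1) fun y hy => ?_
  obtain ⟨hneg, hpos⟩ := hPQ hPs (hDsub hy).2
  exact hcs a b y (hax.trans hxb) (fun x hx => (hbox ⟨hx, hy⟩).1) hneg hpos

end Crossing

section Coordinates

lemma tendsto_slice {P Z : Type*} [TopologicalSpace P] [TopologicalSpace Z]
    {u : P × (ℝ × Z) → ℝ} {s : P} {x : ℝ} {y : Z}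
    (hu : ContinuousAt u (s, (x, y))) :
    Tendsto (fun q : P × Z => u (q.1, (x, q.2))) (𝓝 s ×ˢ 𝓝 y) (𝓝 (u (s, (x, y)))) := by
  rw [← nhds_prod_eq]
  exact ContinuousAt.comp (f := fun q : P × Z => (q.1, (x, q.2))) hu (by fun_prop)

variable {P Z : Type*} [NormedAddCommGroup P] [NormedSpace ℝ P] [NormedAddCommGroup Z]
  [NormedSpace ℝ Z]

lemma hasDerivAt_slice {u : P × (ℝ × Z) → ℝ} {s : P} {x : ℝ} {y : Z}
    (hu : DifferentiableAt ℝ u (s, (x, y))) :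
    HasDerivAt (fun x => u (s, (x, y))) (fderiv ℝ u (s, (x, y)) (0, (1, 0))) x :=
  hu.hasFDerivAt.comp_hasDerivAt x
    ((hasDerivAt_const x s).prodMk ((hasDerivAt_id x).prodMk (hasDerivAt_const x y)))

lemma hasDerivAt_prodMk_left {ρ : ℝ × Z → ℝ} {x : ℝ} {y : Z} (hρ : DifferentiableAt ℝ ρ (x, y)) :
    HasDerivAt (fun x => ρ (x, y)) (fderiv ℝ ρ (x, y) (1, 0)) x :=
  hρ.hasFDerivAt.comp_hasDerivAt x ((hasDerivAt_id x).prodMk (hasDerivAt_const x y))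

lemma eventually_contDiffAt_slice {n : ℕ} {u : P × (ℝ × Z) → ℝ} {s : P} {x : ℝ} {y : Z}
    (hu : ContDiffAt ℝ n u (s, (x, y))) : ∀ᶠ x' in 𝓝 x, ContDiffAt ℝ n u (s, (x', y)) :=
  (Continuous.tendsto (by fun_prop : Continuous fun x : ℝ => (s, (x, y))) x).eventually
    (hu.eventually (by simp))

lemma eventually_slice_neg_and_pos {u : P × (ℝ × Z) → ℝ} {s₀ : P} {x₀ : ℝ} {y₀ : Z}
    (hu : ContDiffAt ℝ 1 u (s₀, (x₀, y₀))) (h0 : u (s₀, (x₀, y₀)) = 0)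
    (hd : 0 < fderiv ℝ u (s₀, (x₀, y₀)) (0, (1, 0))) :
    (∀ᶠ x in 𝓝[<] x₀, ∀ᶠ q in 𝓝 s₀ ×ˢ 𝓝 y₀, u (q.1, (x, q.2)) < 0) ∧
      ∀ᶠ x in 𝓝[>] x₀, ∀ᶠ q in 𝓝 s₀ ×ˢ 𝓝 y₀, 0 < u (q.1, (x, q.2)) := by
  have hsign : ∀ᶠ x in 𝓝 x₀, SignType.sign (u (s₀, (x, y₀))) = SignType.sign (x - x₀) :=
    eventually_nhdsWithin_sign_eq_of_deriv_pos (f := fun x => u (s₀, (x, y₀)))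
      ((hasDerivAt_slice (hu.differentiableAt one_ne_zero)).deriv ▸ hd) h0
  have hboth := hsign.and (eventually_contDiffAt_slice (n := 1) hu)
  constructor
  · filter_upwards [hboth.filter_mono nhdsWithin_le_nhds, self_mem_nhdsWithin] with x hx hlt
    rw [sign_neg (sub_neg.2 hlt), sign_eq_neg_one_iff] at hx
    exact (tendsto_slice hx.2.continuousAt).eventually (gt_mem_nhds hx.1)
  · filter_upwards [hboth.filter_mono nhdsWithin_le_nhds, self_mem_nhdsWithin] with x hx hlt
    rw [sign_pos (sub_pos.2 hlt), sign_eq_one_iff] at hx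
    exact (tendsto_slice hx.2.continuousAt).eventually (lt_mem_nhds hx.1)

lemma exists_mem_nhds_strictMonoOn_slice {u : P × (ℝ × Z) → ℝ} {s₀ : P} {z₀ : ℝ × Z}
    (hu : ContDiffAt ℝ 1 u (s₀, z₀)) (hd : 0 < fderiv ℝ u (s₀, z₀) (0, (1, 0))) :
    ∃ N ∈ 𝓝 z₀, ∀ᶠ s in 𝓝 s₀, ContinuousOn (fun z => u (s, z)) N ∧
      ∀ a b y, (∀ x ∈ Icc a b, (x, y) ∈ N) → StrictMonoOn (fun x => u (s, (x, y))) (Icc a b) := by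
  have hnear : ∀ᶠ q in 𝓝 s₀ ×ˢ 𝓝 z₀, DifferentiableAt ℝ u q ∧
      0 < fderiv ℝ u q (0, (1, 0)) := by
    rw [← nhds_prod_eq]
    exact ((hu.eventually (by simp)).mono fun q hq => hq.differentiableAt one_ne_zero).and
      (((hu.continuousAt_fderiv one_ne_zero).clm_apply continuousAt_const).eventually
        (lt_mem_nhds hd))
  obtain ⟨P₀, hP₀, N, hN, hPN⟩ := eventually_prod_iff.1 hnear
  refine ⟨{z | N z}, hN, hP₀.mono fun s hs => ⟨fun z hz => ?_, fun a b y hab => ?_⟩⟩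
  · exact ((hPN hs hz).1.continuousAt.comp
      (by fun_prop : ContinuousAt (fun z => (s, z)) z)).continuousWithinAt
  · exact strictMonoOn_of_hasDerivWithinAt_pos (convex_Icc a b)
      (fun x hx => (hasDerivAt_slice (hPN hs (hab x hx)).1).continuousAt.continuousWithinAt)
      (fun x hx => (hasDerivAt_slice (hPN hs (hab x (interior_subset hx))).1).hasDerivWithinAt)
      fun x hx => (hPN hs (hab x (interior_subset hx))).2

lemma exists_mem_nhds_convexOn_slice {u : P × (ℝ × Z) → ℝ} {s₀ : P} {z₀ : ℝ × Z}
    (hu : ContDiffAt ℝ 2 u (s₀, z₀))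
    (hd : 0 < fderiv ℝ (fun q => fderiv ℝ u q (0, (1, 0))) (s₀, z₀) (0, (1, 0))) :
    ∃ N ∈ 𝓝 z₀, ∀ᶠ s in 𝓝 s₀, ContinuousOn (fun z => u (s, z)) N ∧
      ∀ a b y, (∀ x ∈ Icc a b, (x, y) ∈ N) → ConvexOn ℝ (Icc a b) fun x => u (s, (x, y)) := by
  have hu₁ : ContDiffAt ℝ 1 (fun q => fderiv ℝ u q (0, (1, 0))) (s₀, z₀) :=
    (hu.fderiv_right (by norm_num)).clm_apply contDiffAt_const
  obtain ⟨N, hN, hmono⟩ := exists_mem_nhds_strictMonoOn_slice hu₁ hd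
  have hdiff : ∀ᶠ q in 𝓝 s₀ ×ˢ 𝓝 z₀, DifferentiableAt ℝ u q := by
    rw [← nhds_prod_eq]
    exact (hu.eventually (by simp)).mono fun q hq => hq.differentiableAt two_ne_zero
  obtain ⟨P₀, hP₀, M, hM, hPM⟩ := eventually_prod_iff.1 hdiff
  refine ⟨N ∩ {z | M z}, inter_mem hN hM, (hmono.and hP₀).mono fun s ⟨hs, hsP⟩ =>
    ⟨fun z hz => ?_, fun a b y hab => ?_⟩⟩
  · exact ((hPM hsP hz.2).continuousAt.comp
      (by fun_prop : ContinuousAt (fun z => (s, z)) z)).continuousWithinAt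
  · have hder : ∀ x ∈ Icc a b, HasDerivAt (fun x => u (s, (x, y)))
        (fderiv ℝ u (s, (x, y)) (0, (1, 0))) x := fun x hx =>
      hasDerivAt_slice (hPM hsP (hab x hx).2)
    refine MonotoneOn.convexOn_of_deriv (convex_Icc a b)
      (fun x hx => (hder x hx).continuousAt.continuousWithinAt)
      (fun x hx => (hder x (interior_subset hx)).differentiableAt.differentiableWithinAt) ?_
    exact ((hs.2 a b y fun x hx => (hab x hx).1).monotoneOn.mono interior_subset).congr
      fun x hx => (hder x (interior_subset hx)).deriv.symm

lemma eventuallyConnectedAt_zeros_of_fderiv_pos {u : P × (ℝ × Z) → ℝ} {s₀ : P} {z₀ : ℝ × Z}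
    (hu : ContDiffAt ℝ 1 u (s₀, z₀)) (h0 : u (s₀, z₀) = 0)
    (hd : 0 < fderiv ℝ u (s₀, z₀) (0, (1, 0))) :
    EventuallyConnectedAt (𝓝 s₀) (fun s => {z | u (s, z) = 0}) z₀ := by
  obtain ⟨N, hN, hmono⟩ := exists_mem_nhds_strictMonoOn_slice hu hd
  obtain ⟨hneg, hpos⟩ := eventually_slice_neg_and_pos hu h0 hd
  refine eventuallyConnectedAt_zeros_of_crossesUp hN (hmono.mono fun s hs => hs.1) ?_ hneg hpos
  filter_upwards [hmono] with s hs a b y hlt hab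
  exact crossesUp_of_strictMonoOn hlt.le (hs.1.comp (by fun_prop) hab) (hs.2 a b y hab)

lemma fderiv_fderiv_pos_of_eq_sq {u : P × (ℝ × Z) → ℝ} {ρ : ℝ × Z → ℝ} {s₀ : P} {x₀ : ℝ} {y₀ : Z}
    (hu : ContDiffAt ℝ 2 u (s₀, (x₀, y₀))) (hρ : ContDiffAt ℝ 2 ρ (x₀, y₀)) (h0 : ρ (x₀, y₀) = 0)
    (hd : 0 < fderiv ℝ ρ (x₀, y₀) (1, 0)) (huρ : ∀ᶠ z in 𝓝 (x₀, y₀), u (s₀, z) = ρ z ^ 2) :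
    0 < fderiv ℝ (fun q => fderiv ℝ u q (0, (1, 0))) (s₀, (x₀, y₀)) (0, (1, 0)) := by
  let r : ℝ → ℝ := fun x => ρ (x, y₀)
  have hr : ContDiffAt ℝ 2 r x₀ := hρ.comp x₀ (by fun_prop)
  have hr' : deriv r x₀ = fderiv ℝ ρ (x₀, y₀) (1, 0) :=
    (hasDerivAt_prodMk_left (hρ.differentiableAt two_ne_zero)).deriv
  have hr₁ : HasDerivAt r (deriv r x₀) x₀ := (hr.differentiableAt two_ne_zero).hasDerivAt
  have hr₂ : DifferentiableAt ℝ (deriv r) x₀ :=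
    ((hr.fderiv_right (m := 1) (by norm_num)).clm_apply contDiffAt_const).differentiableAt
      one_ne_zero
  have hfirst : (fun x => fderiv ℝ u (s₀, (x, y₀)) (0, (1, 0))) =ᶠ[𝓝 x₀]
      fun x => 2 * r x * deriv r x := by
    have hx : Tendsto (fun x : ℝ => (x, y₀)) (𝓝 x₀) (𝓝 (x₀, y₀)) :=
      Continuous.tendsto (by fun_prop) x₀
    have hq : Tendsto (fun x : ℝ => (s₀, (x, y₀))) (𝓝 x₀) (𝓝 (s₀, (x₀, y₀))) :=
      Continuous.tendsto (by fun_prop) x₀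
    filter_upwards [(hx.eventually huρ).eventually_nhds, hr.eventually (by simp),
      hq.eventually (hu.eventually (by simp))] with x hx hrx hux
    rw [← (hasDerivAt_slice (hux.differentiableAt two_ne_zero)).deriv, EventuallyEq.deriv_eq hx,
      ((hrx.differentiableAt two_ne_zero).hasDerivAt.fun_pow 2).deriv]
    simp
  have hu₁ : DifferentiableAt ℝ (fun q => fderiv ℝ u q (0, (1, 0))) (s₀, (x₀, y₀)) :=
    ((hu.fderiv_right (m := 1) (by norm_num)).clm_apply contDiffAt_const).differentiableAt
      one_ne_zero
  rw [← (hasDerivAt_slice hu₁).deriv, hfirst.deriv_eq,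
    ((hr₁.const_mul 2).fun_mul hr₂.hasDerivAt).deriv, show r x₀ = 0 from h0, hr']
  simp only [mul_zero, zero_mul, add_zero, gt_iff_lt]
  positivity

lemma hasFDerivAt_comp_snd {ρ : Z → ℝ} {s : P} {z : Z} (hρ : DifferentiableAt ℝ ρ z) :
    HasFDerivAt (fun q : P × Z => ρ q.2) ((fderiv ℝ ρ z).comp (.snd ℝ P Z)) (s, z) :=
  hρ.hasFDerivAt.comp (s, z) hasFDerivAt_snd

lemma eventuallyConnectedAt_min_zeros {u : P × (ℝ × Z) → ℝ} {ρ : ℝ × Z → ℝ} {s₀ : P} {z₀ : ℝ × Z}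
    {l : Filter P} (hl : l ≤ 𝓝 s₀) (hu : ContDiffAt ℝ 2 u (s₀, z₀)) (hρ : ContDiffAt ℝ 2 ρ z₀)
    (h0 : ρ z₀ = 0) (hd : 0 < fderiv ℝ ρ z₀ (1, 0))
    (huρ : ∀ᶠ z in 𝓝 z₀, u (s₀, z) = ρ z ^ 2)
    (hneg : ∀ᶠ q in l ×ˢ 𝓝 z₀, ρ q.2 = 0 → u q < 0) :
    EventuallyConnectedAt l (fun s => {z | min (ρ z) (u (s, z)) = 0}) z₀ := by
  have hρ₁ : ContDiffAt ℝ 1 (fun q : P × (ℝ × Z) => ρ q.2) (s₀, z₀) :=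
    (hρ.of_le one_le_two).comp (s₀, z₀) contDiffAt_snd
  have hρd : 0 < fderiv ℝ (fun q : P × (ℝ × Z) => ρ q.2) (s₀, z₀) (0, (1, 0)) := by
    rwa [(hasFDerivAt_comp_snd (hρ.differentiableAt two_ne_zero)).fderiv]
  obtain ⟨N₁, hN₁, hmono⟩ := exists_mem_nhds_strictMonoOn_slice hρ₁ hρd
  obtain ⟨N₂, hN₂, hconv⟩ := exists_mem_nhds_convexOn_slice hu
    (fderiv_fderiv_pos_of_eq_sq hu hρ h0 hd huρ)
  obtain ⟨P₀, hP₀, N₃, hN₃, hneg⟩ := eventually_prod_iff.1 hneg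
  obtain ⟨hleft, hright⟩ := eventually_slice_neg_and_pos hρ₁ h0 hρd
  refine eventuallyConnectedAt_zeros_of_crossesUp (inter_mem (inter_mem hN₁ hN₂) hN₃) ?_ ?_ ?_ ?_
  · filter_upwards [hl hmono, hl hconv] with s hms hcs
    exact ContinuousOn.inf
      (hms.1.mono (inter_subset_left.trans inter_subset_left))
      (hcs.1.mono (inter_subset_left.trans inter_subset_right))
  · filter_upwards [hl hmono, hl hconv, hP₀] with s hms hcs hs a b y hlt hab
    exact crossesUp_min hlt.le (hms.1.comp (by fun_prop) fun x hx => (hab x hx).1.1)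
      (hms.2 a b y fun x hx => (hab x hx).1.1)
      (hcs.1.comp (by fun_prop) fun x hx => (hab x hx).1.2)
      (hcs.2 a b y fun x hx => (hab x hx).1.2) fun x hx => hneg hs (hab x hx).2
  · filter_upwards [hleft] with x hx
    exact (hx.filter_mono (prod_mono_left _ hl)).mono fun q hq => min_lt_of_left_lt hq
  · have hux : ∀ᶠ x in 𝓝 z₀.1, u (s₀, (x, z₀.2)) = ρ (x, z₀.2) ^ 2 :=
      (Continuous.tendsto (by fun_prop : Continuous fun x : ℝ => (x, z₀.2)) z₀.1).eventually huρ
    filter_upwards [hright, hux.filter_mono nhdsWithin_le_nhds,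
      (eventually_contDiffAt_slice (n := 2) hu).filter_mono nhdsWithin_le_nhds] with x hρx hux hcx
    have hρpos : 0 < ρ (x, z₀.2) := (nhds_prod_eq (x := s₀) (y := z₀.2) ▸ hρx).self_of_nhds
    have hpos : 0 < u (s₀, (x, z₀.2)) := hux ▸ pow_pos hρpos 2
    filter_upwards [hρx.filter_mono (prod_mono_left _ hl),
      ((tendsto_slice hcx.continuousAt).mono_left (prod_mono_left _ hl)).eventually
        (lt_mem_nhds hpos)] with q hρq huq
    exact lt_min hρq huq

end Coordinates

section Manifold

lemma exists_continuousLinearEquiv_prod_ker {E : Type*} [NormedAddCommGroup E] [NormedSpace ℝ E]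
    {ℓ : E →L[ℝ] ℝ} (hℓ : ℓ ≠ 0) : ∃ e : E ≃L[ℝ] ℝ × ℓ.ker, ℓ (e.symm (1, 0)) = 1 := by
  obtain ⟨w, hw⟩ := LinearMap.surjective (f := ℓ.toLinearMap)
    (fun h => hℓ (ContinuousLinearMap.coe_injective h)) 1
  have hw' : ℓ w = 1 := hw
  exact ⟨.equivOfRightInverse ℓ (.toSpanSingleton ℝ w) fun t => by simp [hw'], by simp [hw']⟩

variable {P E M : Type*} [NormedAddCommGroup P] [NormedSpace ℝ P] [NormedAddCommGroup E]
  [NormedSpace ℝ E] [TopologicalSpace M] [ChartedSpace E M]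

lemma mvfderiv_eq_fderiv_comp_chart_symm {F : Type*} [NormedAddCommGroup F] [NormedSpace ℝ F]
    {f : M → F} {p : M} (hf : MDifferentiableAt 𝓘(ℝ, E) 𝓘(ℝ, F) f p) :
    mvfderiv 𝓘(ℝ, E) f p = fderiv ℝ (f ∘ (chartAt E p).symm) (chartAt E p p) := by
  change mfderiv 𝓘(ℝ, E) 𝓘(ℝ, F) f p = _
  rw [hf.mfderiv]
  simp only [writtenInExtChartAt, mfld_simps, fderivWithin_univ]
  rfl

lemma contDiffAt_comp_prodMap_symm {Z F : Type*} [NormedAddCommGroup Z] [NormedSpace ℝ Z]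
    [NormedAddCommGroup F] [NormedSpace ℝ F] {n : WithTop ℕ∞} {u : P × M → F} {s : P} {p : M}
    {φ : OpenPartialHomeomorph M Z} (hp : p ∈ φ.source)
    (hφ : ContMDiffAt 𝓘(ℝ, Z) 𝓘(ℝ, E) n φ.symm (φ p))
    (hu : ContMDiffAt (𝓘(ℝ, P).prod 𝓘(ℝ, E)) 𝓘(ℝ, F) n u (s, p)) :
    ContDiffAt ℝ n (fun z : P × Z => u (z.1, φ.symm z.2)) (s, φ p) := by
  rw [← φ.left_inv hp] at hu
  have hcomp := hu.comp (s, φ p) (contMDiffAt_id.prodMap hφ)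
  rw [← modelWithCornersSelf_prod, chartedSpaceSelf_prod] at hcomp
  exact hcomp.contDiffAt

lemma exists_adapted_chart {n : WithTop ℕ∞} [IsManifold 𝓘(ℝ, E) n M] {ρ : M → ℝ} {p : M}
    (hρ : MDifferentiableAt 𝓘(ℝ, E) 𝓘(ℝ, ℝ) ρ p) (hd : mvfderiv 𝓘(ℝ, E) ρ p ≠ 0) :
    ∃ (Z : Submodule ℝ E) (φ : OpenPartialHomeomorph M (ℝ × Z)), p ∈ φ.source ∧
      ContMDiffAt 𝓘(ℝ, ℝ × Z) 𝓘(ℝ, E) n φ.symm (φ p) ∧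
      0 < fderiv ℝ (ρ ∘ φ.symm) (φ p) (1, 0) := by
  rw [mvfderiv_eq_fderiv_comp_chart_symm hρ] at hd
  obtain ⟨e, he⟩ := exists_continuousLinearEquiv_prod_ker (E := E) hd
  refine ⟨_, (chartAt E p).trans e.toHomeomorph.toOpenPartialHomeomorph, by simp, ?_, ?_⟩
  · have hsymm : ContMDiffAt 𝓘(ℝ, E) 𝓘(ℝ, E) n (chartAt E p).symm (e.symm (e (chartAt E p p))) := by
      rw [e.symm_apply_apply]
      exact contMDiffOn_chart_symm.contMDiffAt ((chartAt E p).open_target.mem_nhds (by simp))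
    exact hsymm.comp (e (chartAt E p p)) e.symm.contDiff.contMDiff.contMDiffAt
  · change 0 < fderiv ℝ ((ρ ∘ (chartAt E p).symm) ∘ e.symm) (e (chartAt E p p)) (1, 0)
    rw [e.symm.comp_right_fderiv, e.symm_apply_apply]
    exact one_pos.trans_eq he.symm

lemma fderiv_prod_eq_fderiv_slice {Z : Type*} [NormedAddCommGroup Z] [NormedSpace ℝ Z]
    {u : P × Z → ℝ} {s : P} {z : Z} (hu : DifferentiableAt ℝ u (s, z)) (w : Z) :
    fderiv ℝ u (s, z) (0, w) = fderiv ℝ (fun z => u (s, z)) z w := by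
  have hslice : HasFDerivAt (fun z => u (s, z)) _ z :=
    hu.hasFDerivAt.comp z (hasFDerivAt_prodMk_right s z)
  rw [hslice.fderiv]
  simp

lemma contMDiffAt_slice {n : WithTop ℕ∞} {u : P × M → ℝ} {s : P} {p : M}
    (hu : ContMDiffAt (𝓘(ℝ, P).prod 𝓘(ℝ, E)) 𝓘(ℝ, ℝ) n u (s, p)) :
    ContMDiffAt 𝓘(ℝ, E) 𝓘(ℝ, ℝ) n (fun x => u (s, x)) p :=
  hu.comp p (contMDiffAt_const.prodMk contMDiffAt_id)

lemma eventuallyConnectedAt_zeros [IsManifold 𝓘(ℝ, E) 1 M] {u : P × M → ℝ} {s₀ : P} {p : M}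
    (hu : ContMDiffAt (𝓘(ℝ, P).prod 𝓘(ℝ, E)) 𝓘(ℝ, ℝ) 1 u (s₀, p)) (h0 : u (s₀, p) = 0)
    (hd : mvfderiv 𝓘(ℝ, E) (fun x => u (s₀, x)) p ≠ 0) :
    EventuallyConnectedAt (𝓝 s₀) (fun s => {x | u (s, x) = 0}) p := by
  obtain ⟨Z, φ, hp, hφ, hφd⟩ := exists_adapted_chart (n := 1)
    ((contMDiffAt_slice hu).mdifferentiableAt one_ne_zero) hd
  have huφ := contDiffAt_comp_prodMap_symm hp hφ hu
  refine .of_openPartialHomeomorph φ hp (eventuallyConnectedAt_zeros_of_fderiv_pos huφ ?_ ?_) ?_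
  · rwa [φ.left_inv hp]
  · rw [fderiv_prod_eq_fderiv_slice (huφ.differentiableAt one_ne_zero)]
    exact hφd
  · filter_upwards [tendsto_snd.eventually (φ.eventually_left_inverse hp)] with z hz
    simp only [hz]

lemma eventuallyConnectedAt_sheet [IsManifold 𝓘(ℝ, E) 2 M] {u : P × M → ℝ} {ρ : M → ℝ} {s₀ : P}
    {p : M} {l : Filter P} (hl : l ≤ 𝓝 s₀)
    (hu : ContMDiffAt (𝓘(ℝ, P).prod 𝓘(ℝ, E)) 𝓘(ℝ, ℝ) 2 u (s₀, p))
    (hρ : ContMDiffAt 𝓘(ℝ, E) 𝓘(ℝ, ℝ) 2 ρ p) (h0 : ρ p = 0) (hd : mvfderiv 𝓘(ℝ, E) ρ p ≠ 0)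
    (huρ : ∀ᶠ x in 𝓝 p, u (s₀, x) = ρ x ^ 2)
    (hneg : ∀ᶠ q in l ×ˢ 𝓝 p, ρ q.2 = 0 → u q < 0) :
    EventuallyConnectedAt l (fun s => {x | u (s, x) = 0 ∧ 0 < ρ x}) p := by
  obtain ⟨Z, φ, hp, hφ, hφd⟩ := exists_adapted_chart (n := 2)
    (hρ.mdifferentiableAt two_ne_zero) hd
  have hρφ : ContDiffAt ℝ 2 (ρ ∘ φ.symm) (φ p) := by
    rw [← φ.left_inv hp] at hρ
    exact (hρ.comp (φ p) hφ).contDiffAt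
  have hsymm : Tendsto φ.symm (𝓝 (φ p)) (𝓝 p) := φ.tendsto_symm hp
  refine .of_openPartialHomeomorph φ hp (eventuallyConnectedAt_min_zeros hl
    (contDiffAt_comp_prodMap_symm hp hφ hu) hρφ (by simpa [φ.left_inv hp] using h0)
    hφd (hsymm.eventually huρ)
    ((tendsto_id.prodMap hsymm).eventually hneg)) ?_
  filter_upwards [tendsto_snd.eventually (φ.eventually_left_inverse hp), hneg] with z hz hneg
  simp only [Function.comp_apply, hz]
  constructor
  · rintro ⟨hu0, hρ0⟩
    rw [hu0, min_eq_right hρ0.le]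
  · intro hmin
    have hρ0 : ρ z.2 ≠ 0 := fun h => (hneg h).not_ge (hmin ▸ min_le_right _ _)
    have hρ' : 0 < ρ z.2 := (hmin ▸ min_le_left _ _ : 0 ≤ ρ z.2).lt_of_ne' hρ0
    exact ⟨(min_choice _ _).elim (fun h => absurd (h.symm.trans hmin) hρ0) fun h =>
      h.symm.trans hmin, hρ'⟩

lemma eventually_mul_deriv_pos {u : ℝ × E → ℝ} {s₀ : ℝ} {v₀ : E} (hu : ContDiffAt ℝ 1 u (s₀, v₀))
    (hd : deriv (fun s => u (s, v₀)) s₀ ≠ 0) :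
    ∀ᶠ z in 𝓝 (s₀, v₀), z.1 ≠ s₀ →
      0 < (u z - u (s₀, z.2)) * (deriv (fun s => u (s, v₀)) s₀ * (z.1 - s₀)) := by
  have hstrict := hu.hasStrictFDerivAt one_ne_zero
  have hderiv : deriv (fun s => u (s, v₀)) s₀ = fderiv ℝ u (s₀, v₀) (1, 0) :=
    (hstrict.hasFDerivAt.comp_hasDerivAt s₀
      ((hasDerivAt_id s₀).prodMk (hasDerivAt_const s₀ v₀))).deriv
  generalize deriv (fun s => u (s, v₀)) s₀ = c at *
  have hpair : Tendsto (fun z : ℝ × E => (z, (s₀, z.2))) (𝓝 (s₀, v₀)) (𝓝 ((s₀, v₀), (s₀, v₀))) :=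
    (by fun_prop : Continuous fun z : ℝ × E => (z, (s₀, z.2))).tendsto (s₀, v₀)
  filter_upwards [hpair.eventually (hstrict.isLittleO.def (half_pos (abs_pos.2 hd)))] with z hz hne
  have hsub : z - (s₀, z.2) = (z.1 - s₀) • ((1 : ℝ), (0 : E)) := by ext <;> simp
  rw [hsub, map_smul, ← hderiv, norm_smul, Prod.norm_mk, norm_one, norm_zero,
    max_eq_left zero_le_one, mul_one, Real.norm_eq_abs, Real.norm_eq_abs, smul_eq_mul] at hz
  set h := z.1 - s₀
  have hch : 0 < |c| * |h| := mul_pos (abs_pos.2 hd) (abs_pos.2 (sub_ne_zero.2 hne))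
  have herr : |(u z - u (s₀, z.2) - h * c) * (c * h)| ≤ |c| / 2 * |h| * (|c| * |h|) := by
    rw [abs_mul, abs_mul c h]
    gcongr
  have hsq : c * h * (c * h) = |c| * |h| * (|c| * |h|) := by
    rw [← abs_mul, abs_mul_abs_self]
  nlinarith [(abs_le.1 herr).1, mul_pos hch hch]

lemma eventually_pos_or_neg_of_eq_sq [IsManifold 𝓘(ℝ, E) 1 M] {u : ℝ × M → ℝ} {ρ : M → ℝ} {s₀ : ℝ}
    {p : M} {l : Filter ℝ} (hl : l ≤ 𝓝 s₀)
    (hside : (∀ᶠ s in l, s₀ < s) ∨ ∀ᶠ s in l, s < s₀)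
    (hu : ContMDiffAt (𝓘(ℝ, ℝ).prod 𝓘(ℝ, E)) 𝓘(ℝ, ℝ) 1 u (s₀, p))
    (hd : deriv (fun s => u (s, p)) s₀ ≠ 0) (huρ : ∀ᶠ x in 𝓝 p, u (s₀, x) = ρ x ^ 2) :
    (∀ᶠ q in l ×ˢ 𝓝 p, 0 < u q) ∨ ∀ᶠ q in l ×ˢ 𝓝 p, ρ q.2 = 0 → u q < 0 := by
  set c := deriv (fun s => u (s, p)) s₀
  let φ := chartAt E p
  have hp : p ∈ φ.source := mem_chart_source E p
  have hcsign : (∀ᶠ s in l, 0 < c * (s - s₀)) ∨ ∀ᶠ s in l, c * (s - s₀) < 0 := by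
    rcases hd.lt_or_gt with hc | hc <;> rcases hside with h | h
    · exact .inr (h.mono fun s hs => mul_neg_of_neg_of_pos hc (sub_pos.2 hs))
    · exact .inl (h.mono fun s hs => mul_pos_of_neg_of_neg hc (sub_neg.2 hs))
    · exact .inl (h.mono fun s hs => mul_pos hc (sub_pos.2 hs))
    · exact .inr (h.mono fun s hs => mul_neg_of_pos_of_neg hc (sub_neg.2 hs))
  have hmul : ∀ᶠ q in l ×ˢ 𝓝 p, q.1 ≠ s₀ → 0 < (u q - ρ q.2 ^ 2) * (c * (q.1 - s₀)) := by
    have huφ := contDiffAt_comp_prodMap_symm hp (contMDiffOn_chart_symm.contMDiffAt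
      (φ.open_target.mem_nhds (φ.map_source hp))) hu
    have hev := eventually_mul_deriv_pos huφ (by simpa only [φ.left_inv hp] using hd)
    simp only [φ.left_inv hp] at hev
    rw [nhds_prod_eq] at hev
    filter_upwards [(tendsto_id.prodMap (φ.continuousAt hp)).eventually
      (hev.filter_mono (prod_mono_left _ hl)),
      tendsto_snd.eventually (φ.eventually_left_inverse hp), tendsto_snd.eventually huρ]
      with q hq hqp hqρ
    simpa only [Prod.map, id, hqp, hqρ] using hq
  refine hcsign.imp (fun h => ?_) fun h => ?_
  · filter_upwards [hmul, tendsto_fst.eventually h] with q hq hc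
    have := pos_of_mul_pos_left (hq (by rintro h; simp [h] at hc)) hc.le
    linarith [sq_nonneg (ρ q.2)]
  · filter_upwards [hmul, tendsto_fst.eventually h] with q hq hc hρ
    have := neg_of_mul_pos_left (hq (by rintro h; simp [h] at hc)) hc.le
    simpa [hρ] using this

end Manifold

section Immersion

variable {E F M : Type*} [NormedAddCommGroup E] [NormedSpace ℝ E] [NormedAddCommGroup F]
  [NormedSpace ℝ F] [TopologicalSpace M] [ChartedSpace E M] {n : WithTop ℕ∞}

lemma mdifferentiable_of_mem_maximalAtlas [IsManifold 𝓘(ℝ, E) n M] (hn : n ≠ 0)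
    {e : OpenPartialHomeomorph M E} (he : e ∈ IsManifold.maximalAtlas 𝓘(ℝ, E) n M) :
    e.MDifferentiable 𝓘(ℝ, E) 𝓘(ℝ, E) :=
  ⟨(contMDiffOn_of_mem_maximalAtlas he).mdifferentiableOn hn,
    (contMDiffOn_symm_of_mem_maximalAtlas he).mdifferentiableOn hn⟩

lemma codChart_apply_eq {f : M → F} {p : M}
    (him : Manifold.IsImmersionAt 𝓘(ℝ, E) 𝓘(ℝ, F) n f p) {x : M} (hx : x ∈ him.domChart.source) :
    him.codChart (f x) = him.equiv (him.domChart x, 0) := by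
  have h := him.writtenInCharts
  simp only [EqOn, mfld_simps] at h
  simpa only [him.domChart.left_inv hx] using h (him.domChart.map_source hx)

lemma mvfderiv_injective_of_isImmersionAt [IsManifold 𝓘(ℝ, E) n M] (hn : n ≠ 0) {f : M → F} {p : M}
    (him : Manifold.IsImmersionAt 𝓘(ℝ, E) 𝓘(ℝ, F) n f p) :
    Function.Injective (mvfderiv 𝓘(ℝ, E) f p) := by
  have hdom := mdifferentiable_of_mem_maximalAtlas hn him.domChart_mem_maximalAtlas
  have hcod := mdifferentiable_of_mem_maximalAtlas hn him.codChart_mem_maximalAtlas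
  let i : E →L[ℝ] F := him.equiv ∘L ContinuousLinearMap.inl ℝ E him.complement
  have hcomp : him.codChart ∘ f =ᶠ[𝓝 p] i ∘ him.domChart := by
    filter_upwards [him.domChart.open_source.mem_nhds him.mem_domChart_source] with x hx
    exact codChart_apply_eq him hx
  have hcodf := mfderiv_comp p (hcod.mdifferentiableAt him.mem_codChart_source)
    (him.contMDiffAt.mdifferentiableAt hn)
  have hidom := mfderiv_comp p i.mdifferentiableAt (hdom.mdifferentiableAt him.mem_domChart_source)
  rw [i.mfderiv_eq] at hidom
  have hi : Function.Injective i := him.equiv.injective.comp fun v w h => congrArg Prod.fst h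
  have hinj := hi.comp (hdom.mfderiv_injective him.mem_domChart_source)
  have heq := congrArg (fun T : E →L[ℝ] F => (T : E → F))
    (hcodf.symm.trans (hcomp.mfderiv_eq.trans hidom))
  exact Function.Injective.of_comp (Eq.subst (motive := Function.Injective) heq.symm hinj)

lemma eventually_mem_range_iff {g : M → F} (hg : IsEmbedding g) {q : M}
    (him : Manifold.IsImmersionAt 𝓘(ℝ, E) 𝓘(ℝ, F) n g q) :
    ∀ᶠ y in 𝓝 (g q), y ∈ range g ↔ (him.equiv.symm (him.codChart y)).2 = 0 := by
  set φ := him.domChart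
  set ψ := him.codChart
  obtain ⟨O, hO, hOφ⟩ := hg.isInducing.isOpen_iff.1 φ.open_source
  have hqO : g q ∈ O := hOφ.symm.subset him.mem_domChart_source
  have hφq : (him.equiv.symm (ψ (g q))).1 ∈ φ.target := by
    rw [codChart_apply_eq him him.mem_domChart_source, him.equiv.symm_apply_apply]
    exact φ.map_source him.mem_domChart_source
  have hcont : ContinuousAt (fun y => (him.equiv.symm (ψ y)).1) (g q) :=
    (continuous_fst.comp him.equiv.symm.continuous).continuousAt.comp
      (ψ.continuousAt him.mem_codChart_source)
  filter_upwards [hO.mem_nhds hqO, ψ.open_source.mem_nhds him.mem_codChart_source,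
    hcont (φ.open_target.mem_nhds hφq)] with y hyO hyψ hyφ
  constructor
  · rintro ⟨x, rfl⟩
    rw [codChart_apply_eq him (hOφ.subset hyO), him.equiv.symm_apply_apply]
  · intro hy
    have hx := φ.map_target hyφ
    refine ⟨φ.symm _, ψ.injOn (him.source_subset_preimage_source hx) hyψ ?_⟩
    rw [codChart_apply_eq him hx, φ.right_inv hyφ, ← hy]
    exact him.equiv.apply_symm_apply _

lemma finrank_complement_eq_one [FiniteDimensional ℝ F]
    (hrank : Module.finrank ℝ F = Module.finrank ℝ E + 1) {g : M → F} {q : M}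
    (him : Manifold.IsImmersionAt 𝓘(ℝ, E) 𝓘(ℝ, F) n g q) :
    Module.finrank ℝ him.complement = 1 := by
  have : FiniteDimensional ℝ (E × him.complement) := him.equiv.symm.toLinearEquiv.finiteDimensional
  have : FiniteDimensional ℝ E :=
    .of_surjective (LinearMap.fst ℝ E him.complement) Prod.fst_surjective
  have : FiniteDimensional ℝ him.complement :=
    .of_surjective (LinearMap.snd ℝ E him.complement) Prod.snd_surjective
  have hsum := him.equiv.toLinearEquiv.finrank_eq
  rw [Module.finrank_prod] at hsum
  omega

end Immersion

section DefiningFunction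

variable {E F M : Type*} [NormedAddCommGroup E] [NormedSpace ℝ E] [NormedAddCommGroup F]
  [NormedSpace ℝ F] [TopologicalSpace M] [ChartedSpace E M]

/-- `h` is a local defining function at `x` of the hypersurface `A`: near `x` it is smooth, has
nonzero differential, and vanishes exactly on `A`. -/
structure IsDefiningFunction (A : Set F) (h : F → ℝ) (x : F) : Prop where
  contDiffAt : ContDiffAt ℝ ∞ h x
  eventually_mem_iff : ∀ᶠ y in 𝓝 x, y ∈ A ↔ h y = 0
  fderiv_ne_zero : fderiv ℝ h x ≠ 0

lemma exists_isDefiningFunction [FiniteDimensional ℝ F]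
    (hrank : Module.finrank ℝ F = Module.finrank ℝ E + 1) {g : M → F}
    (hg : Manifold.IsSmoothEmbedding 𝓘(ℝ, E) 𝓘(ℝ, F) ∞ g) (q : M) :
    ∃ h, IsDefiningFunction (range g) h (g q) := by
  have him := hg.isImmersion.isImmersionAt q
  have hcod := mdifferentiable_of_mem_maximalAtlas (by simp) him.codChart_mem_maximalAtlas
  have hsmooth : ContDiffAt ℝ ∞ him.codChart (g q) :=
    ((contMDiffOn_of_mem_maximalAtlas him.codChart_mem_maximalAtlas).contMDiffAt
      (him.codChart.open_source.mem_nhds him.mem_codChart_source)).contDiffAt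
  have hone := finrank_complement_eq_one hrank him
  have : FiniteDimensional ℝ him.complement := .of_finrank_eq_succ hone
  let ℓ : him.complement ≃L[ℝ] ℝ := .ofFinrankEq (by simpa using hone)
  let L : F →L[ℝ] ℝ := ℓ ∘L ContinuousLinearMap.snd ℝ E him.complement ∘L him.equiv.symm
  refine ⟨L ∘ him.codChart, L.contDiff.contDiffAt.comp _ hsmooth, ?_, ?_⟩
  · filter_upwards [eventually_mem_range_iff hg.isEmbedding him] with y hy
    exact hy.trans ℓ.map_eq_zero_iff.symm
  · have hsurj : Function.Surjective (fderiv ℝ (L ∘ him.codChart) (g q)) := by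
      have hd := (hsmooth.differentiableAt (by simp)).hasFDerivAt
      rw [(L.hasFDerivAt.comp (g q) hd).fderiv, ← mfderiv_eq_fderiv]
      exact (ℓ.surjective.comp (Prod.snd_surjective.comp him.equiv.symm.surjective)).comp
        (hcod.mfderiv_surjective him.mem_codChart_source)
    intro hzero
    obtain ⟨v, hv⟩ := hsurj 1
    simp [hzero] at hv

lemma mvfderiv_congr {u w : M → F} {p : M} (huw : u =ᶠ[𝓝 p] w) :
    mvfderiv 𝓘(ℝ, E) u p = mvfderiv 𝓘(ℝ, E) w p :=
  ContinuousLinearMap.ext fun v => DFunLike.congr_fun (F := E →L[ℝ] F) huw.mfderiv_eq v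

lemma mvfderiv_comp_eq_fderiv_comp {f : M → F} {h : F → ℝ} {p : M}
    (hh : DifferentiableAt ℝ h (f p)) (hf : MDifferentiableAt 𝓘(ℝ, E) 𝓘(ℝ, F) f p) (v : E) :
    mvfderiv 𝓘(ℝ, E) (h ∘ f) p v = fderiv ℝ h (f p) (mvfderiv 𝓘(ℝ, E) f p v) := by
  rw [← mfderiv_eq_fderiv]
  exact mvfderiv_comp_apply p hh.mdifferentiableAt hf v

lemma range_mvfderiv_le_ker_iff {f : M → F} {h : F → ℝ} {p : M}
    (hh : DifferentiableAt ℝ h (f p)) (hf : MDifferentiableAt 𝓘(ℝ, E) 𝓘(ℝ, F) f p) :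
    (mvfderiv 𝓘(ℝ, E) f p).range ≤ (fderiv ℝ h (f p)).ker ↔ mvfderiv 𝓘(ℝ, E) (h ∘ f) p = 0 := by
  constructor
  · intro hle
    ext v
    exact (mvfderiv_comp_eq_fderiv_comp hh hf v).trans (hle ⟨v, rfl⟩)
  · rintro hzero _ ⟨v, rfl⟩
    exact (mvfderiv_comp_eq_fderiv_comp hh hf v).symm.trans (DFunLike.congr_fun hzero v)

variable {g : M → F} {h : F → ℝ} {q : M}

lemma IsDefiningFunction.differentiableAt {A : Set F} {x : F} (hh : IsDefiningFunction A h x) :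
    DifferentiableAt ℝ h x :=
  hh.contDiffAt.differentiableAt (by simp)

lemma IsDefiningFunction.range_mvfderiv_le_ker (hh : IsDefiningFunction (range g) h (g q))
    (hg : MDifferentiableAt 𝓘(ℝ, E) 𝓘(ℝ, F) g q) :
    (mvfderiv 𝓘(ℝ, E) g q).range ≤ (fderiv ℝ h (g q)).ker := by
  refine (range_mvfderiv_le_ker_iff hh.differentiableAt hg).2 ?_
  have hzero : h ∘ g =ᶠ[𝓝 q] 0 := by
    filter_upwards [hg.continuousAt.eventually hh.eventually_mem_iff] with x hx
    exact hx.1 ⟨x, rfl⟩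
  exact (mvfderiv_congr hzero).trans mvfderiv_zero

lemma IsDefiningFunction.not_le_ker (hh : IsDefiningFunction (range g) h (g q))
    (hg : MDifferentiableAt 𝓘(ℝ, E) 𝓘(ℝ, F) g q) {V : Submodule ℝ F}
    (hV : V ⊔ (mvfderiv 𝓘(ℝ, E) g q).range = ⊤) : ¬ V ≤ (fderiv ℝ h (g q)).ker := by
  intro hle
  have htop : (⊤ : Submodule ℝ F) ≤ (fderiv ℝ h (g q)).ker :=
    hV ▸ sup_le hle (hh.range_mvfderiv_le_ker hg)
  exact hh.fderiv_ne_zero (ContinuousLinearMap.ext fun y => htop (Submodule.mem_top (x := y)))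

end DefiningFunction

section Fold

variable {P E F M : Type*} [NormedAddCommGroup P] [NormedSpace ℝ P] [NormedAddCommGroup E]
  [NormedSpace ℝ E] [NormedAddCommGroup F] [NormedSpace ℝ F] [TopologicalSpace M]
  [ChartedSpace E M] {A : Set F} {h : F → ℝ} {ρ : M → ℝ} {p : M}

lemma IsDefiningFunction.eventually_mem_preimage_iff {X : Type*} [TopologicalSpace X] {Φ : X → F}
    {x : X} (hh : IsDefiningFunction A h (Φ x)) (hΦ : ContinuousAt Φ x) :
    ∀ᶠ y in 𝓝 x, Φ y ∈ A ↔ h (Φ y) = 0 :=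
  hΦ.eventually hh.eventually_mem_iff

lemma IsDefiningFunction.eventuallyConnectedAt_preimage [IsManifold 𝓘(ℝ, E) 1 M] {Φ : P → M → F}
    {s₀ : P} (hh : IsDefiningFunction A h (Φ s₀ p)) (hA : Φ s₀ p ∈ A)
    (hΦ : ContMDiffAt (𝓘(ℝ, P).prod 𝓘(ℝ, E)) 𝓘(ℝ, F) ∞ (fun z : P × M => Φ z.1 z.2) (s₀, p))
    (hd : ¬ (mvfderiv 𝓘(ℝ, E) (Φ s₀) p).range ≤ (fderiv ℝ h (Φ s₀ p)).ker) :
    EventuallyConnectedAt (𝓝 s₀) (fun s => Φ s ⁻¹' A) p := by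
  have hu := hh.contDiffAt.contMDiffAt.comp (s₀, p) hΦ
  have hslice : ContMDiffAt 𝓘(ℝ, E) 𝓘(ℝ, F) ∞ (Φ s₀) p :=
    hΦ.comp p (contMDiffAt_const.prodMk contMDiffAt_id)
  rw [range_mvfderiv_le_ker_iff hh.differentiableAt (hslice.mdifferentiableAt (by simp))] at hd
  refine (eventuallyConnectedAt_zeros (hu.of_le (by simp))
    (hh.eventually_mem_iff.self_of_nhds.1 hA) hd).congr ?_
  rw [← nhds_prod_eq]
  exact hh.eventually_mem_preimage_iff (Φ := fun z : P × M => Φ z.1 z.2) hΦ.continuousAt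

lemma mvfderiv_eq_zero_of_eventually_eq_sq {u ρ : M → ℝ}
    (hρ : MDifferentiableAt 𝓘(ℝ, E) 𝓘(ℝ, ℝ) ρ p) (h0 : ρ p = 0) (hu : ∀ᶠ x in 𝓝 p, u x = ρ x ^ 2) :
    mvfderiv 𝓘(ℝ, E) u p = 0 := by
  have hsq : u =ᶠ[𝓝 p] ρ * ρ := hu.mono fun x hx => hx.trans (sq (ρ x))
  rw [mvfderiv_congr hsq, mvfderiv_mul hρ hρ, h0]
  simp

variable (E) in
/-- The map `f` is folded along the hypersurface `A` at `p`: the defining function `h` of `A` pulls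
back to the square of a function `ρ`, a local defining function of the fold. -/
structure IsFold (f : M → F) (A : Set F) (h : F → ℝ) (ρ : M → ℝ) (p : M) : Prop where
  isDefiningFunction : IsDefiningFunction A h (f p)
  comp_eq_sq : ∀ᶠ x in 𝓝 p, h (f x) = ρ x ^ 2
  contMDiffAt : ContMDiffAt 𝓘(ℝ, E) 𝓘(ℝ, ℝ) ∞ ρ p
  eq_zero : ρ p = 0
  mvfderiv_ne_zero : mvfderiv 𝓘(ℝ, E) ρ p ≠ 0

namespace IsFold

lemma neg {f : M → F} (hf : IsFold E f A h ρ p) : IsFold E f A h (-ρ) p where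
  isDefiningFunction := hf.isDefiningFunction
  comp_eq_sq := by simpa only [Pi.neg_apply, neg_sq] using hf.comp_eq_sq
  contMDiffAt := hf.contMDiffAt.neg
  eq_zero := by simp [hf.eq_zero]
  mvfderiv_ne_zero := by
    rw [mvfderiv_neg]
    exact neg_ne_zero.2 hf.mvfderiv_ne_zero

lemma mem {f : M → F} (hf : IsFold E f A h ρ p) : f p ∈ A := by
  rw [hf.isDefiningFunction.eventually_mem_iff.self_of_nhds, hf.comp_eq_sq.self_of_nhds, hf.eq_zero,
    zero_pow two_ne_zero]

lemma range_mvfderiv_le_ker {f : M → F} (hf : IsFold E f A h ρ p)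
    (hd : MDifferentiableAt 𝓘(ℝ, E) 𝓘(ℝ, F) f p) :
    (mvfderiv 𝓘(ℝ, E) f p).range ≤ (fderiv ℝ h (f p)).ker :=
  (range_mvfderiv_le_ker_iff hf.isDefiningFunction.differentiableAt hd).2 <|
    mvfderiv_eq_zero_of_eventually_eq_sq (hf.contMDiffAt.mdifferentiableAt (by simp)) hf.eq_zero
      hf.comp_eq_sq

lemma not_transversal {f g : M → F} {q : M} (hf : IsFold E f (range g) h ρ p)
    (hd : MDifferentiableAt 𝓘(ℝ, E) 𝓘(ℝ, F) f p) (hg : MDifferentiableAt 𝓘(ℝ, E) 𝓘(ℝ, F) g q)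
    (hpq : f p = g q) :
    (mvfderiv 𝓘(ℝ, E) f p).range ⊔ (mvfderiv 𝓘(ℝ, E) g q).range ≠ ⊤ := fun htop =>
  (hpq ▸ hf.isDefiningFunction).not_le_ker hg htop (hpq ▸ hf.range_mvfderiv_le_ker hd)

lemma eventually_pos_or_neg [IsManifold 𝓘(ℝ, E) 1 M] {Φ : ℝ → M → F} {g : M → F} {s₀ : ℝ} {q : M}
    (hf : IsFold E (Φ s₀) (range g) h ρ p)
    (hΦ : ContMDiffAt (𝓘(ℝ, ℝ).prod 𝓘(ℝ, E)) 𝓘(ℝ, F) ∞ (fun z : ℝ × M => Φ z.1 z.2) (s₀, p))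
    (hg : MDifferentiableAt 𝓘(ℝ, E) 𝓘(ℝ, F) g q) (hpq : Φ s₀ p = g q)
    (hspan : Submodule.span ℝ {deriv (fun s => Φ s p) s₀} ⊔ (mvfderiv 𝓘(ℝ, E) (Φ s₀) p).range ⊔
      (mvfderiv 𝓘(ℝ, E) g q).range = ⊤)
    {l : Filter ℝ} (hl : l ≤ 𝓝 s₀) (hside : (∀ᶠ s in l, s₀ < s) ∨ ∀ᶠ s in l, s < s₀) :
    (∀ᶠ z in l ×ˢ 𝓝 p, 0 < h (Φ z.1 z.2)) ∨
      ∀ᶠ z in l ×ˢ 𝓝 p, ρ z.2 = 0 → h (Φ z.1 z.2) < 0 := by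
  have hh := hf.isDefiningFunction
  have hslice : ContMDiffAt 𝓘(ℝ, E) 𝓘(ℝ, F) ∞ (Φ s₀) p :=
    hΦ.comp p (contMDiffAt_const.prodMk contMDiffAt_id)
  have hpath : ContMDiffAt 𝓘(ℝ, ℝ) 𝓘(ℝ, F) ∞ (fun s => Φ s p) s₀ :=
    hΦ.comp s₀ (contMDiffAt_id.prodMk contMDiffAt_const)
  have hderiv : deriv (fun s => h (Φ s p)) s₀ ≠ 0 := by
    have hvel := (hpath.contDiffAt.differentiableAt (by simp)).hasDerivAt
    rw [← Function.comp_def h, (hh.differentiableAt.hasFDerivAt.comp_hasDerivAt s₀ hvel).deriv]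
    intro hzero
    refine (hpq ▸ hh).not_le_ker hg hspan (hpq ▸ sup_le ?_
      (hf.range_mvfderiv_le_ker (hslice.mdifferentiableAt (by simp))))
    exact (Submodule.span_singleton_le_iff_mem _ _).2 hzero
  exact eventually_pos_or_neg_of_eq_sq hl hside
    ((hh.contDiffAt.contMDiffAt.comp (s₀, p) hΦ).of_le (by simp)) hderiv hf.comp_eq_sq

lemma eventuallyConnectedAt_sheet [IsManifold 𝓘(ℝ, E) 2 M] {Φ : P → M → F} {s₀ : P}
    (hf : IsFold E (Φ s₀) A h ρ p)
    (hΦ : ContMDiffAt (𝓘(ℝ, P).prod 𝓘(ℝ, E)) 𝓘(ℝ, F) ∞ (fun z : P × M => Φ z.1 z.2) (s₀, p))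
    {l : Filter P} (hl : l ≤ 𝓝 s₀)
    (hneg : ∀ᶠ z in l ×ˢ 𝓝 p, ρ z.2 = 0 → h (Φ z.1 z.2) < 0) :
    EventuallyConnectedAt l (fun s => Φ s ⁻¹' A ∩ {x | 0 < ρ x}) p := by
  have hh := hf.isDefiningFunction
  have hle : (2 : WithTop ℕ∞) ≤ ∞ := WithTop.coe_le_coe.2 (le_top : (2 : ℕ∞) ≤ ⊤)
  refine (EventuallyConnectedAt.congr (Bubbles.eventuallyConnectedAt_sheet hl
    ((hh.contDiffAt.contMDiffAt.comp (s₀, p) hΦ).of_le hle) (hf.contMDiffAt.of_le hle) hf.eq_zero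
    hf.mvfderiv_ne_zero hf.comp_eq_sq hneg) ?_)
  have hmem := hh.eventually_mem_preimage_iff (Φ := fun z : P × M => Φ z.1 z.2) hΦ.continuousAt
  rw [nhds_prod_eq] at hmem
  filter_upwards [hmem.filter_mono (prod_mono_left _ hl)] with z hz
  exact and_congr_left' hz

end IsFold

end Fold

section FoldParity

variable {E F M : Type*} [NormedAddCommGroup E] [NormedSpace ℝ E] [NormedAddCommGroup F]
  [NormedSpace ℝ F] [TopologicalSpace M] [ChartedSpace E M] {Φ : ℝ → M → F} {A : Set F} {s₀ : ℝ}
  {l : Filter ℝ} {C W : Set M} {h : F → ℝ} {ρ : M → ℝ}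

lemma eventually_preimage_inter_eq_empty_of_pos (hl : l ≤ 𝓝 s₀)
    (hΦ : Continuous fun z : ℝ × M => Φ z.1 z.2) (hC : IsCompact C)
    (hlim : ∀ U, IsOpen U → C ⊆ U → ∀ᶠ s in l, Φ s ⁻¹' A ∩ W ⊆ U)
    (hh : ∀ p ∈ C, IsDefiningFunction A h (Φ s₀ p))
    (hpos : ∀ p ∈ C, ∀ᶠ z in l ×ˢ 𝓝 p, 0 < h (Φ z.1 z.2)) : ∀ᶠ s in l, Φ s ⁻¹' A ∩ W = ∅ := by
  have hnot : ∀ p ∈ C, ∀ᶠ z in l ×ˢ 𝓝 p, Φ z.1 z.2 ∉ A := fun p hp => by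
    have hmem := (hh p hp).eventually_mem_preimage_iff (Φ := fun z : ℝ × M => Φ z.1 z.2)
      (x := (s₀, p)) hΦ.continuousAt
    rw [nhds_prod_eq] at hmem
    filter_upwards [hpos p hp, hmem.filter_mono (prod_mono_left _ hl)] with z hz hiff hzA
    exact hz.ne' (hiff.1 hzA)
  filter_upwards [eventually_forall_mem_inter hC hlim hnot] with s hs
  exact eq_empty_of_forall_notMem fun x hx => hs x hx hx.1

lemma eventually_hasComponentParity_zero_of_neg [IsManifold 𝓘(ℝ, E) 2 M] (hl : l ≤ 𝓝 s₀)
    (hΦ : ContMDiff (𝓘(ℝ, ℝ).prod 𝓘(ℝ, E)) 𝓘(ℝ, F) ∞ fun z : ℝ × M => Φ z.1 z.2)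
    (hC : IsCompact C) (hconn : IsConnected C) (hW : IsOpen W) (hCW : C ⊆ W)
    (hlim : ∀ U, IsOpen U → C ⊆ U → ∀ᶠ s in l, Φ s ⁻¹' A ∩ W ⊆ U)
    (hfold : ∀ p ∈ C, IsFold E (Φ s₀) A h ρ p)
    (hneg : ∀ p ∈ C, ∀ᶠ z in l ×ˢ 𝓝 p, ρ z.2 = 0 → h (Φ z.1 z.2) < 0) :
    ∀ᶠ s in l, HasComponentParity (Φ s ⁻¹' A ∩ W) 0 := by
  have hsheet (σ : M → ℝ) (hσ : ∀ p ∈ C, IsFold E (Φ s₀) A h σ p)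
      (hσneg : ∀ p ∈ C, ∀ᶠ z in l ×ˢ 𝓝 p, σ z.2 = 0 → h (Φ z.1 z.2) < 0) :
      ∀ᶠ s in l, IsConnected (Φ s ⁻¹' A ∩ {x | 0 < σ x} ∩ W) :=
    eventually_isConnected_inter hC hconn hW hCW
      (fun p hp => (hσ p hp).eventuallyConnectedAt_sheet hΦ.contMDiffAt hl (hσneg p hp))
      fun U hU hCU => (hlim U hU hCU).mono fun s hs =>
        (inter_subset_inter_left W inter_subset_left).trans hs
  have hoff : ∀ p ∈ C, ∀ᶠ z in l ×ˢ 𝓝 p,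
      Φ z.1 z.2 ∈ A → ContinuousAt ρ z.2 ∧ ρ z.2 ≠ 0 := fun p hp => by
    have hmem := (hfold p hp).isDefiningFunction.eventually_mem_preimage_iff
      (Φ := fun z : ℝ × M => Φ z.1 z.2) (x := (s₀, p)) hΦ.continuous.continuousAt
    have hcont : ∀ᶠ x in 𝓝 p, ContinuousAt ρ x :=
      ((contMDiffAt_iff_contMDiffAt_nhds (by simp)).1
        ((hfold p hp).contMDiffAt.of_le (m := 1) (by simp))).mono fun x hx => hx.continuousAt
    rw [nhds_prod_eq] at hmem
    filter_upwards [hneg p hp, hmem.filter_mono (prod_mono_left _ hl),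
      tendsto_snd.eventually hcont] with z hz hiff hzρ hzA
    exact ⟨hzρ, fun h0 => (hz h0).ne (hiff.1 hzA)⟩
  filter_upwards [hsheet ρ hfold hneg, hsheet (-ρ) (fun p hp => (hfold p hp).neg)
      (by simpa only [Pi.neg_apply, neg_eq_zero] using hneg),
    eventually_forall_mem_inter hC hlim hoff] with s hpos hneg hs
  refine hasComponentParity_zero_of_pos_neg (fun x hx => hs x hx hx.1)
    (by rwa [inter_right_comm]) ?_
  simpa only [Pi.neg_apply, neg_pos, inter_right_comm] using hneg

lemma eventually_hasComponentParity_zero_of_isFold [IsManifold 𝓘(ℝ, E) 2 M] {g : M → F} [l.NeBot]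
    (hl : l ≤ 𝓝 s₀) (hside : (∀ᶠ s in l, s₀ < s) ∨ ∀ᶠ s in l, s < s₀)
    (hΦ : ContMDiff (𝓘(ℝ, ℝ).prod 𝓘(ℝ, E)) 𝓘(ℝ, F) ∞ fun z : ℝ × M => Φ z.1 z.2)
    (hg : MDifferentiable 𝓘(ℝ, E) 𝓘(ℝ, F) g) (hC : IsCompact C) (hconn : IsConnected C)
    (hW : IsOpen W) (hCW : C ⊆ W)
    (hlim : ∀ U, IsOpen U → C ⊆ U → ∀ᶠ s in l, Φ s ⁻¹' range g ∩ W ⊆ U)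
    (hfold : ∀ p ∈ C, IsFold E (Φ s₀) (range g) h ρ p)
    (hspan : ∀ p ∈ C, ∀ q, Φ s₀ p = g q →
      Submodule.span ℝ {deriv (fun s => Φ s p) s₀} ⊔ (mvfderiv 𝓘(ℝ, E) (Φ s₀) p).range ⊔
        (mvfderiv 𝓘(ℝ, E) g q).range = ⊤) :
    ∀ᶠ s in l, HasComponentParity (Φ s ⁻¹' range g ∩ W) 0 := by
  have hdich : ∀ p ∈ C, (∀ᶠ z in l ×ˢ 𝓝 p, 0 < h (Φ z.1 z.2)) ∨
      ∀ᶠ z in l ×ˢ 𝓝 p, ρ z.2 = 0 → h (Φ z.1 z.2) < 0 := fun p hp => by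
    obtain ⟨q, hq⟩ := (hfold p hp).mem
    exact (hfold p hp).eventually_pos_or_neg hΦ.contMDiffAt (hg q) hq.symm
      (hspan p hp q hq.symm) hl hside
  obtain hpos | hneg := forall_eventually_or_of_isPreconnected hconn.isPreconnected
    (Q := fun z => 0 < h (Φ z.1 z.2)) (R := fun z => ρ z.2 = 0 → h (Φ z.1 z.2) < 0)
    (fun p hp s hs => lt_asymm hs.1 (hs.2 (hfold p hp).eq_zero)) hdich
  · filter_upwards [eventually_preimage_inter_eq_empty_of_pos hl hΦ.continuous hC hlim
      (fun p hp => (hfold p hp).isDefiningFunction) hpos] with s hs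
    exact hs ▸ hasComponentParity_empty
  · exact eventually_hasComponentParity_zero_of_neg hl hΦ hC hconn hW hCW hlim hfold hneg

end FoldParity

section TransversalParity

variable {P E F M : Type*} [NormedAddCommGroup P] [NormedSpace ℝ P] [NormedAddCommGroup E]
  [NormedSpace ℝ E] [NormedAddCommGroup F] [NormedSpace ℝ F] [FiniteDimensional ℝ F]
  [TopologicalSpace M] [ChartedSpace E M] [IsManifold 𝓘(ℝ, E) ∞ M]

lemma eventually_hasComponentParity_one_of_transversal
    (hrank : Module.finrank ℝ F = Module.finrank ℝ E + 1) {Φ : P → M → F} {g : M → F} {s₀ : P}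
    {C W : Set M} (hΦ : ContMDiff (𝓘(ℝ, P).prod 𝓘(ℝ, E)) 𝓘(ℝ, F) ∞ fun z : P × M => Φ z.1 z.2)
    (hg : Manifold.IsSmoothEmbedding 𝓘(ℝ, E) 𝓘(ℝ, F) ∞ g) (hC : IsCompact C)
    (hconn : IsConnected C) (hW : IsOpen W) (hCW : C ⊆ W)
    (hlim : ∀ U, IsOpen U → C ⊆ U → ∀ᶠ s in 𝓝 s₀, Φ s ⁻¹' range g ∩ W ⊆ U)
    (htrans : ∀ p ∈ C, ∃ q, Φ s₀ p = g q ∧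
      (mvfderiv 𝓘(ℝ, E) (Φ s₀) p).range ⊔ (mvfderiv 𝓘(ℝ, E) g q).range = ⊤) :
    ∀ᶠ s in 𝓝 s₀, HasComponentParity (Φ s ⁻¹' range g ∩ W) 1 := by
  have hsheet : ∀ p ∈ C, EventuallyConnectedAt (𝓝 s₀) (fun s => Φ s ⁻¹' range g) p := by
    intro p hp
    obtain ⟨q, hpq, htop⟩ := htrans p hp
    obtain ⟨h, hh⟩ := exists_isDefiningFunction hrank hg q
    have hker := hh.not_le_ker (hg.isImmersion.contMDiff.mdifferentiableAt (by simp)) htop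
    rw [← hpq] at hh hker
    exact hh.eventuallyConnectedAt_preimage (hpq ▸ mem_range_self q) hΦ.contMDiffAt hker
  exact (eventually_isConnected_inter hC hconn hW hCW hsheet hlim).mono fun s hs =>
    hasComponentParity_one_of_isConnected hs

end TransversalParity

section Model

lemma modelParabola_inter_modelPlane : modelParabola ∩ modelPlane = modelCircle := by
  ext x
  simp only [modelParabola, modelPlane, modelCircle, mem_inter_iff, mem_ofPred_eq, axisDist]
  refine and_congr_left fun hx => ?_
  rw [hx, ← Real.sqrt_eq_one]
  constructor
  · intro h
    nlinarith
  · rintro h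
    norm_num [h]

lemma mem_modelParabola_iff {x : E3} : x ∈ modelParabola ↔ x 2 = (axisDist x - 1) ^ 2 := by
  rw [modelParabola, mem_ofPred_eq]
  ring_nf

lemma axisDist_eq_one {x : E3} (hx : x ∈ modelCircle) : axisDist x = 1 :=
  Real.sqrt_eq_one.2 hx.1

lemma contDiffAt_axisDist {x : E3} (hx : x ∈ modelCircle) : ContDiffAt ℝ ∞ axisDist x :=
  ContDiffAt.sqrt (by fun_prop) (by rw [hx.1]; exact one_ne_zero)

lemma hasFDerivAt_axisDist {x : E3} (hx : x ∈ modelCircle) :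
    HasFDerivAt axisDist
      (x 0 • (EuclideanSpace.proj 0 : E3 →L[ℝ] ℝ) +
        x 1 • (EuclideanSpace.proj 1 : E3 →L[ℝ] ℝ)) x := by
  have hproj (i : Fin 3) :
      HasFDerivAt (fun y : E3 => y i) (EuclideanSpace.proj i : E3 →L[ℝ] ℝ) x :=
    (EuclideanSpace.proj i : E3 →L[ℝ] ℝ).hasFDerivAt
  refine HasFDerivAt.congr_fderiv (((hproj 0).pow 2).add ((hproj 1).pow 2) |>.sqrt ?_) ?_
  · change x 0 ^ 2 + x 1 ^ 2 ≠ 0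
    simp [hx.1]
  · ext y
    simp [hx.1]
    ring

lemma hasFDerivAt_axisDist_sub_one {Ψ : E3 → E3} {Ψ' : E3 →L[ℝ] E3} {x : E3}
    (hx : Ψ x ∈ modelCircle) (hΨ : HasFDerivAt Ψ Ψ' x) :
    HasFDerivAt (fun y => axisDist (Ψ y) - 1) ((Ψ x 0 • (EuclideanSpace.proj 0 : E3 →L[ℝ] ℝ) +
      Ψ x 1 • (EuclideanSpace.proj 1 : E3 →L[ℝ] ℝ)) ∘L Ψ') x :=
  ((hasFDerivAt_axisDist hx).comp x hΨ).sub_const 1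

/-- The hypotheses say that `D` takes values in the line tangent to the circle at `b`. -/
lemma not_injective_of_forall_tangent {b : E3} (hb : b ∈ modelCircle)
    {D : EuclideanSpace ℝ (Fin 2) →L[ℝ] E3} (h01 : ∀ v, b 0 * D v 0 + b 1 * D v 1 = 0)
    (h2 : ∀ v, D v 2 = 0) : ¬ Function.Injective D := by
  intro hD
  let T : EuclideanSpace ℝ (Fin 2) →ₗ[ℝ] ℝ :=
    ((b 0 • (EuclideanSpace.proj 1 : E3 →L[ℝ] ℝ) - b 1 • (EuclideanSpace.proj 0 : E3 →L[ℝ] ℝ)) ∘L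
      D).toLinearMap
  obtain ⟨v, hv, hv0⟩ := (Submodule.ne_bot_iff _).1
    (LinearMap.ker_ne_bot_of_finrank_lt (f := T) (by simp))
  have hT : b 0 * D v 1 - b 1 * D v 0 = 0 := hv
  refine hv0 (hD ?_)
  rw [map_zero]
  ext i
  fin_cases i
  · change D v 0 = 0
    linear_combination b 0 * h01 v - b 1 * hT - D v 0 * hb.1
  · change D v 1 = 0
    linear_combination b 1 * h01 v + b 0 * hT - D v 1 * hb.1
  · exact h2 v

/-- A chart carrying `A` and `B` to the rotated parabola and the plane. -/
structure IsModelChart (A B : Set E3) (Ψ : OpenPartialHomeomorph E3 E3) : Prop where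
  contDiffOn : ContDiffOn ℝ ∞ Ψ Ψ.source
  contDiffOn_symm : ContDiffOn ℝ ∞ Ψ.symm Ψ.target
  isImage_parabola : Ψ.IsImage A modelParabola
  isImage_plane : Ψ.IsImage B modelPlane

lemma HasModelTangency.exists_isModelChart {A B γ : Set E3} (h : HasModelTangency A B γ) :
    ∃ Ψ, IsModelChart A B Ψ ∧ γ = A ∩ B ∩ Ψ.source := by
  obtain ⟨Ψ, hΨ, hΨ', hγ, -, hγimage, hA, hB⟩ := h
  have hA' : Ψ.IsImage A modelParabola := .of_image_eq (by rwa [inter_comm, inter_comm Ψ.target])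
  have hB' : Ψ.IsImage B modelPlane := .of_image_eq (by rwa [inter_comm, inter_comm Ψ.target])
  have hcircle : Ψ.IsImage (A ∩ B) (Ψ '' γ) := by
    rw [hγimage, ← modelParabola_inter_modelPlane]
    exact hA'.inter hB'
  refine ⟨Ψ, ⟨hΨ, hΨ', hA', hB'⟩, Subset.antisymm (fun x hx => ?_) fun x hx => ?_⟩
  · exact ⟨(hcircle (hγ hx)).1 (mem_image_of_mem Ψ hx), hγ hx⟩
  · exact (Ψ.injOn.mem_image_iff hγ hx.2).1 ((hcircle hx.2).2 hx.1)

namespace IsModelChart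

variable {A B : Set E3} {Ψ : OpenPartialHomeomorph E3 E3} {x : E3}

lemma contDiffAt (hΨ : IsModelChart A B Ψ) (hx : x ∈ Ψ.source) : ContDiffAt ℝ ∞ Ψ x :=
  hΨ.contDiffOn.contDiffAt (Ψ.open_source.mem_nhds hx)

lemma hasFDerivAt (hΨ : IsModelChart A B Ψ) (hx : x ∈ Ψ.source) :
    HasFDerivAt Ψ (fderiv ℝ Ψ x) x :=
  ((hΨ.contDiffAt hx).differentiableAt (by simp)).hasFDerivAt

lemma mem_modelCircle (hΨ : IsModelChart A B Ψ) (hx : x ∈ Ψ.source) (hA : x ∈ A) (hB : x ∈ B) :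
    Ψ x ∈ modelCircle :=
  modelParabola_inter_modelPlane ▸ (hΨ.isImage_parabola.inter hΨ.isImage_plane hx).2 ⟨hA, hB⟩

lemma fderiv_bijective (hΨ : IsModelChart A B Ψ) (hx : x ∈ Ψ.source) :
    Function.Bijective (fderiv ℝ Ψ x) := by
  have hmd : Ψ.MDifferentiable 𝓘(ℝ, E3) 𝓘(ℝ, E3) :=
    ⟨(hΨ.contDiffOn.differentiableOn (by simp)).mdifferentiableOn,
      (hΨ.contDiffOn_symm.differentiableOn (by simp)).mdifferentiableOn⟩
  rw [← mfderiv_eq_fderiv]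
  exact hmd.mfderiv_bijective hx

lemma hasFDerivAt_apply_two (hΨ : IsModelChart A B Ψ) (hx : x ∈ Ψ.source) :
    HasFDerivAt (fun y => Ψ y 2) ((EuclideanSpace.proj 2 : E3 →L[ℝ] ℝ) ∘L fderiv ℝ Ψ x) x :=
  (EuclideanSpace.proj 2 : E3 →L[ℝ] ℝ).hasFDerivAt.comp x (hΨ.hasFDerivAt hx)

lemma isDefiningFunction (hΨ : IsModelChart A B Ψ) (hx : x ∈ Ψ.source) :
    IsDefiningFunction B (fun y => Ψ y 2) x where
  contDiffAt := (contDiffAt_piLp 2).1 (hΨ.contDiffAt hx) 2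
  eventually_mem_iff := by
    filter_upwards [Ψ.open_source.mem_nhds hx] with y hy using (hΨ.isImage_plane hy).symm
  fderiv_ne_zero := by
    obtain ⟨v, hv⟩ := (hΨ.fderiv_bijective hx).2 (EuclideanSpace.single 2 1)
    rw [(hΨ.hasFDerivAt_apply_two hx).fderiv]
    intro hzero
    simpa [hv] using DFunLike.congr_fun hzero v

lemma apply_two_eq_sq (hΨ : IsModelChart A B Ψ) (hx : x ∈ Ψ.source) (hA : x ∈ A) :
    Ψ x 2 = (axisDist (Ψ x) - 1) ^ 2 :=
  mem_modelParabola_iff.1 ((hΨ.isImage_parabola hx).2 hA)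

lemma isFold {f : S2 → E3} (hf : IsSphereEmbedding f) (hΨ : IsModelChart (range f) B Ψ) {p : S2}
    (hp : f p ∈ Ψ.source) (hB : f p ∈ B) :
    IsFold (EuclideanSpace ℝ (Fin 2)) f B (fun x => Ψ x 2) (fun q => axisDist (Ψ (f q)) - 1) p := by
  have hc := hΨ.mem_modelCircle hp ⟨p, rfl⟩ hB
  have hh := hΨ.isDefiningFunction hp
  have hside : ContDiffAt ℝ ∞ (fun x => axisDist (Ψ x) - 1) (f p) :=
    ((contDiffAt_axisDist hc).comp (f p) (hΨ.contDiffAt hp)).sub contDiffAt_const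
  have hρ : ContMDiffAt (𝓡 2) 𝓘(ℝ, ℝ) ∞ (fun q => axisDist (Ψ (f q)) - 1) p :=
    hside.contMDiffAt.comp p hf.contMDiff.contMDiffAt
  have hsq : ∀ᶠ q in 𝓝 p, Ψ (f q) 2 = (axisDist (Ψ (f q)) - 1) ^ 2 := by
    filter_upwards [hf.contMDiff.continuous.continuousAt.eventually (Ψ.open_source.mem_nhds hp)]
      with q hq using hΨ.apply_two_eq_sq hq (mem_range_self q)
  have hρ0 : axisDist (Ψ (f p)) - 1 = 0 := sub_eq_zero.2 (axisDist_eq_one hc)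
  have hinj := (hΨ.fderiv_bijective hp).1.comp
    (mvfderiv_injective_of_isImmersionAt (by simp) (hf.isImmersion.isImmersionAt p))
  have hfd : MDifferentiableAt (𝓡 2) (𝓡 3) f p := hf.contMDiff.mdifferentiable (by simp) p
  refine ⟨hh, hsq, hρ, hρ0, fun hρzero => not_injective_of_forall_tangent hc
    (D := fderiv ℝ Ψ (f p) ∘L mvfderiv (𝓡 2) f p) (fun v => ?_) (fun v => ?_) hinj⟩
  · have hker := (range_mvfderiv_le_ker_iff (hside.differentiableAt (by simp)) hfd).2 hρzero
    rw [(hasFDerivAt_axisDist_sub_one hc (hΨ.hasFDerivAt hp)).fderiv] at hker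
    exact hker ⟨v, rfl⟩
  · have hker := (range_mvfderiv_le_ker_iff hh.differentiableAt hfd).2
      (mvfderiv_eq_zero_of_eventually_eq_sq (hρ.mdifferentiableAt (by simp)) hρ0 hsq)
    rw [(hΨ.hasFDerivAt_apply_two hp).fderiv] at hker
    exact hker ⟨v, rfl⟩

end IsModelChart

lemma HasModelTangency.exists_isFold {f : S2 → E3} {B γ : Set E3} {C : Set S2} {p : S2}
    (h : HasModelTangency (range f) B γ) (hγ : IsClosed γ) (hf : IsSphereEmbedding f)
    (hC : IsPreconnected C) (hCB : C ⊆ f ⁻¹' B) (hpC : p ∈ C) (hp : f p ∈ γ) :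
    ∃ h ρ, ∀ q ∈ C, IsFold (EuclideanSpace ℝ (Fin 2)) f B h ρ q := by
  obtain ⟨Ψ, hΨ, rfl⟩ := h.exists_isModelChart
  have hcont := hf.contMDiff.continuous
  have hsub : C ⊆ f ⁻¹' Ψ.source := by
    refine (isPreconnected_iff_subset_of_disjoint.1 hC _ _ (Ψ.open_source.preimage hcont)
      (hγ.preimage hcont).isOpen_compl (fun q _ => ?_) ?_).resolve_right fun h => h hpC hp
    · exact or_iff_not_imp_left.2 fun hq hqγ => hq hqγ.2
    · refine eq_empty_of_forall_notMem fun q ⟨hqC, hq, hqγ⟩ => ?_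
      exact hqγ ⟨⟨mem_range_self q, hCB hqC⟩, hq⟩
  exact ⟨_, _, fun q hq => hΨ.isFold hf (hsub hq) (hCB hq)⟩

end Model

section Regular

variable {f g : S2 → E3} {F : ℝ → S2 → E3} {s₀ : ℝ} {C W : Set S2}

/-- The set of parameters in the domain of `f` at which `f` meets `g` transversally. -/
def transversalLocus (f g : S2 → E3) : Set S2 :=
  {p | ∃ q, f p = g q ∧ tangentImage f p ⊔ tangentImage g q = ⊤}

lemma transversalLocus_subset : transversalLocus f g ⊆ f ⁻¹' range g :=
  fun _ ⟨q, hq, _⟩ => ⟨q, hq.symm⟩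

lemma Transversal.transversalLocus_eq (h : Transversal f g) :
    transversalLocus f g = f ⁻¹' range g :=
  transversalLocus_subset.antisymm fun p ⟨q, hq⟩ => ⟨q, hq.symm, h p q hq.symm⟩

/-- A good family defined for all real times, critical only at isolated times. -/
structure IsRegularFamily (g : S2 → E3) (F : ℝ → S2 → E3) : Prop where
  smooth : ContMDiff (𝓘(ℝ, ℝ).prod (𝓡 2)) (𝓡 3) ∞ fun z : ℝ × S2 => F z.1 z.2
  embedding : ∀ s, IsSphereEmbedding (F s)
  link : ∀ s, IsLink (range (F s) ∩ range g)
  transversal : ∀ s p q, F s p = g q →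
    Submodule.span ℝ {deriv (fun s => F s p) s} ⊔ tangentImage (F s) p ⊔ tangentImage g q = ⊤
  eventually_transversal : ∀ s₀, ∀ᶠ s in 𝓝[≠] s₀, Transversal (F s) g
  model : ∀ s p q, F s p = g q → tangentImage (F s) p ⊔ tangentImage g q ≠ ⊤ →
    ∃ γ, IsKnot γ ∧ F s p ∈ γ ∧ HasModelTangency (range (F s)) (range g) γ

lemma IsSphereEmbedding.mdifferentiable (hf : IsSphereEmbedding f) :
    MDifferentiable (𝓡 2) (𝓡 3) f :=
  hf.isImmersion.contMDiff.mdifferentiable (by simp)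

lemma IsSphereEmbedding.isClosed_range (hf : IsSphereEmbedding f) : IsClosed (range f) :=
  (isCompact_range hf.isEmbedding.continuous).isClosed

lemma IsKnot.isClosed {γ : Set E3} : IsKnot γ → IsClosed γ := by
  rintro ⟨c, hc, rfl⟩
  exact (isCompact_range hc.isEmbedding.continuous).isClosed

lemma IsKnot.isConnected {γ : Set E3} : IsKnot γ → IsConnected γ := by
  rintro ⟨c, hc, rfl⟩
  exact isConnected_range hc.isEmbedding.continuous

lemma IsKnot.isConnected_preimage {γ : Set E3} (hγ : IsKnot γ) (hf : IsSphereEmbedding f)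
    (hγf : γ ⊆ range f) : IsConnected (f ⁻¹' γ) :=
  hγ.isConnected.preimage_of_isClosedMap hf.isEmbedding.injective
    hf.isEmbedding.continuous.isClosedMap hγf

namespace IsRegularFamily

lemma eventually_inter_subset (hF : IsRegularFamily g F) (hg : IsSphereEmbedding g)
    (hWC : F s₀ ⁻¹' range g ∩ closure W ⊆ C) {U : Set S2} (hU : IsOpen U) (hCU : C ⊆ U) :
    ∀ᶠ s in 𝓝 s₀, F s ⁻¹' range g ∩ W ⊆ U :=
  eventually_preimage_inter_subset hF.smooth.continuous hg.isClosed_range hU (hWC.trans hCU)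

lemma eventually_hasComponentParity_of_tangency (hF : IsRegularFamily g F)
    (hg : IsSphereEmbedding g) (hC : IsCompact C) (hconn : IsConnected C) (hW : IsOpen W)
    (hCW : C ⊆ W) (hCg : C ⊆ F s₀ ⁻¹' range g) (hWC : F s₀ ⁻¹' range g ∩ closure W ⊆ C)
    (htan : ¬ C ⊆ transversalLocus (F s₀) g) :
    transversalLocus (F s₀) g ∩ W = ∅ ∧
      ∀ᶠ s in 𝓝[≠] s₀, HasComponentParity (F s ⁻¹' range g ∩ W) 0 := by
  obtain ⟨p, hpC, hp⟩ := not_subset.1 htan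
  obtain ⟨q, hq⟩ := hCg hpC
  obtain ⟨γ, hγ, hpγ, hmodel⟩ := hF.model s₀ p q hq.symm fun htop => hp ⟨q, hq.symm, htop⟩
  obtain ⟨h, ρ, hfold⟩ := hmodel.exists_isFold hγ.isClosed (hF.embedding s₀) hconn.isPreconnected
    hCg hpC hpγ
  have hside {l : Filter ℝ} [l.NeBot] (hl : l ≤ 𝓝 s₀)
      (hls : (∀ᶠ s in l, s₀ < s) ∨ ∀ᶠ s in l, s < s₀) :
      ∀ᶠ s in l, HasComponentParity (F s ⁻¹' range g ∩ W) 0 :=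
    eventually_hasComponentParity_zero_of_isFold hl hls hF.smooth hg.mdifferentiable hC hconn hW hCW
      (fun U hU hCU => hl (hF.eventually_inter_subset hg hWC hU hCU)) hfold
      fun p _ q => hF.transversal s₀ p q
  refine ⟨eq_empty_of_forall_notMem fun x ⟨⟨y, hxy, htop⟩, hxW⟩ => ?_, ?_⟩
  · exact (hfold x (hWC ⟨⟨y, hxy.symm⟩, subset_closure hxW⟩)).not_transversal
      ((hF.embedding s₀).mdifferentiable x) (hg.mdifferentiable y) hxy htop
  · rw [← nhdsLT_sup_nhdsGT]
    exact eventually_sup.2 ⟨hside nhdsWithin_le_nhds (.inr self_mem_nhdsWithin),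
      hside nhdsWithin_le_nhds (.inl self_mem_nhdsWithin)⟩

lemma exists_eventually_hasComponentParity_inter (hF : IsRegularFamily g F)
    (hg : IsSphereEmbedding g) (hC : IsCompact C) (hconn : IsConnected C) (hW : IsOpen W)
    (hCW : C ⊆ W) (hCg : C ⊆ F s₀ ⁻¹' range g) (hWC : F s₀ ⁻¹' range g ∩ closure W ⊆ C) :
    ∃ a, ∀ᶠ s in 𝓝 s₀, HasComponentParity (transversalLocus (F s) g ∩ W) a := by
  suffices ∃ a, HasComponentParity (transversalLocus (F s₀) g ∩ W) a ∧
      ∀ᶠ s in 𝓝[≠] s₀, HasComponentParity (F s ⁻¹' range g ∩ W) a by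
    obtain ⟨a, h₀, ha⟩ := this
    rw [← nhdsNE_sup_pure]
    refine ⟨a, eventually_sup.2 ⟨?_, eventually_pure.2 h₀⟩⟩
    filter_upwards [ha, hF.eventually_transversal s₀] with s hs hst
    rwa [hst.transversalLocus_eq]
  by_cases htrans : C ⊆ transversalLocus (F s₀) g
  · have hone := eventually_hasComponentParity_one_of_transversal (by simp) hF.smooth hg hC hconn
      hW hCW (fun U hU => hF.eventually_inter_subset hg hWC hU) htrans
    have hlocus : transversalLocus (F s₀) g ∩ W = F s₀ ⁻¹' range g ∩ W :=
      (inter_subset_inter_left W transversalLocus_subset).antisymm fun p hp =>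
        ⟨htrans (hWC ⟨hp.1, subset_closure hp.2⟩), hp.2⟩
    exact ⟨1, hlocus ▸ hone.self_of_nhds, hone.filter_mono nhdsWithin_le_nhds⟩
  · obtain ⟨hempty, hzero⟩ :=
      hF.eventually_hasComponentParity_of_tangency hg hC hconn hW hCW hCg hWC htrans
    exact ⟨0, hempty ▸ hasComponentParity_empty, hzero⟩

lemma exists_eventually_hasComponentParity (hF : IsRegularFamily g F) (hg : IsSphereEmbedding g)
    (s₀ : ℝ) : ∃ a, ∀ᶠ s in 𝓝 s₀, HasComponentParity (transversalLocus (F s) g) a := by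
  obtain ⟨n, c, hc, hd, hL⟩ := hF.link s₀
  have hknot (i : Fin n) : IsKnot (range (c i)) := ⟨c i, hc i, rfl⟩
  have hcont : Continuous (F s₀) := (hF.embedding s₀).isEmbedding.continuous
  have hcover : F s₀ ⁻¹' range g = ⋃ i, F s₀ ⁻¹' range (c i) := by
    rw [← preimage_iUnion, ← hL, preimage_inter, preimage_range, univ_inter]
  have hsub (i : Fin n) : range (c i) ⊆ range (F s₀) ∩ range g :=
    hL ▸ subset_iUnion (fun i => range (c i)) i
  have hclosed (i : Fin n) : IsClosed (F s₀ ⁻¹' range (c i)) := (hknot i).isClosed.preimage hcont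
  obtain ⟨W, hW, hCW, hWd, hWC⟩ := exists_isOpen_inter_closure_subset hclosed
    fun i j hij => (hd i j hij).preimage _
  choose a ha using fun i => hF.exists_eventually_hasComponentParity_inter hg
    (hclosed i).isCompact ((hknot i).isConnected_preimage (hF.embedding s₀)
      ((hsub i).trans inter_subset_left)) (hW i) (hCW i)
    (preimage_mono ((hsub i).trans inter_subset_right)) (hcover ▸ hWC i)
  have hnear : ∀ᶠ s in 𝓝 s₀, F s ⁻¹' range g ∩ univ ⊆ ⋃ i, W i :=
    hF.eventually_inter_subset hg inter_subset_left (isOpen_iUnion hW)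
      (hcover ▸ iUnion_mono hCW)
  refine ⟨∑ i, a i, ?_⟩
  filter_upwards [eventually_all.2 ha, hnear] with s hs hsW
  exact .iUnion hW hWd (transversalLocus_subset.trans ((inter_univ _).superset.trans hsW)) hs

lemma hasComponentParity_unique (hF : IsRegularFamily g F) (hg : IsSphereEmbedding g) {s₀ s₁ : ℝ}
    {a b : ZMod 2} (ha : HasComponentParity (transversalLocus (F s₀) g) a)
    (hb : HasComponentParity (transversalLocus (F s₁) g) b) : a = b := by
  choose parity hparity using hF.exists_eventually_hasComponentParity hg
  have hconst : IsLocallyConstant parity := (IsLocallyConstant.iff_eventually_eq parity).2 fun s =>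
    (hparity s).mono fun s' hs' => (hparity s').self_of_nhds.unique hs'
  rw [ha.unique (hparity s₀).self_of_nhds, hb.unique (hparity s₁).self_of_nhds]
  exact hconst.apply_eq_of_preconnectedSpace s₀ s₁

end IsRegularFamily

lemma Transversal.hasComponentParity (h : Transversal f g) (hf : IsSphereEmbedding f) {n : ℕ}
    {K : Fin n → Set E3} (hK : ∀ i, IsKnot (K i)) (hd : Pairwise (Function.onFun Disjoint K))
    (hL : range f ∩ range g = ⋃ i, K i) : HasComponentParity (transversalLocus f g) n := by
  have hcover : f ⁻¹' range g = ⋃ i, f ⁻¹' K i := by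
    rw [← preimage_iUnion, ← hL, preimage_inter, preimage_range, univ_inter]
  have hsub (i : Fin n) : K i ⊆ range f := (subset_iUnion K i).trans (hL ▸ inter_subset_left)
  rw [h.transversalLocus_eq, hcover]
  simpa using hasComponentParity_iUnion_of_isConnected
    (fun i => (hK i).isClosed.preimage hf.isEmbedding.continuous)
    (fun i j hij => (hd hij).preimage f) fun i => (hK i).isConnected_preimage hf (hsub i)

end Regular

section Reparametrization

variable {g : S2 → E3} {Φ : ℝ → S2 → E3} {t : ℝ} {p : S2}

lemma sin_sq_mem_Icc (s : ℝ) : Real.sin s ^ 2 ∈ Icc (0 : ℝ) 1 :=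
  ⟨sq_nonneg _, Real.sin_sq_le_one s⟩

lemma hasDerivAt_sin_sq (s : ℝ) :
    HasDerivAt (fun s => Real.sin s ^ 2) (2 * Real.sin s * Real.cos s) s := by
  simpa using (Real.hasDerivAt_sin s).fun_pow 2

lemma two_mul_sin_mul_cos_ne_zero {s : ℝ} (hs : Real.sin s ^ 2 ∈ Ioo (0 : ℝ) 1) :
    2 * Real.sin s * Real.cos s ≠ 0 := by
  have hsin : Real.sin s ≠ 0 := pow_ne_zero_iff two_ne_zero |>.1 hs.1.ne'
  have hcos : Real.cos s ≠ 0 := by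
    rw [← pow_ne_zero_iff two_ne_zero, Real.cos_sq']
    exact (sub_pos.2 hs.2).ne'
  positivity

namespace IsGoodFamily

lemma mem_Ioo_of_not_transversal (h0 : Transversal (Φ 0) g) (h1 : Transversal (Φ 1) g)
    (ht : t ∈ Icc (0 : ℝ) 1) (hcrit : ¬ Transversal (Φ t) g) : t ∈ Ioo (0 : ℝ) 1 :=
  ⟨ht.1.lt_of_ne fun h => hcrit (h ▸ h0), ht.2.lt_of_ne fun h => hcrit (h ▸ h1)⟩

lemma hasDerivAt_velocity (hΦ : IsGoodFamily g Φ) (ht : t ∈ Ioo (0 : ℝ) 1) :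
    HasDerivAt (fun t => Φ t p) (velocity Φ t p) t := by
  have hnhds : Icc (0 : ℝ) 1 ∈ 𝓝 t := Icc_mem_nhds ht.1 ht.2
  have hpath : ContMDiffOn 𝓘(ℝ, ℝ) (𝓡 3) ∞ (fun t => Φ t p) (Icc 0 1) :=
    hΦ.smooth.comp (contMDiff_id.prodMk contMDiff_const).contMDiffOn fun t ht => ⟨ht, mem_univ p⟩
  rw [velocity, derivWithin_of_mem_nhds hnhds]
  exact (((contMDiffOn_iff_contDiffOn.1 hpath).contDiffAt hnhds).differentiableAt
    (by simp)).hasDerivAt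

lemma span_deriv_sin_sq (hΦ : IsGoodFamily g Φ) {s : ℝ} (hs : Real.sin s ^ 2 ∈ Ioo (0 : ℝ) 1) :
    Submodule.span ℝ {deriv (fun s => Φ (Real.sin s ^ 2) p) s} =
      Submodule.span ℝ {velocity Φ (Real.sin s ^ 2) p} := by
  have hvel : HasDerivAt (fun s => Φ (Real.sin s ^ 2) p)
      ((2 * Real.sin s * Real.cos s) • velocity Φ (Real.sin s ^ 2) p) s :=
    HasDerivAt.scomp s (hΦ.hasDerivAt_velocity hs) (hasDerivAt_sin_sq s)
  rw [hvel.deriv]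
  exact Submodule.span_singleton_smul_eq (isUnit_iff_ne_zero.2 (two_mul_sin_mul_cos_ne_zero hs)) _

lemma eventually_transversal_sin_sq (hΦ : IsGoodFamily g Φ) (h0 : Transversal (Φ 0) g)
    (h1 : Transversal (Φ 1) g) (s₀ : ℝ) : ∀ᶠ s in 𝓝[≠] s₀, Transversal (Φ (Real.sin s ^ 2)) g := by
  have hne : ∀ᶠ s in 𝓝[≠] s₀, ∀ t ∈ {t ∈ Icc (0 : ℝ) 1 | ¬ Transversal (Φ t) g},
      Real.sin s ^ 2 ≠ t := by
    refine (eventually_all_finite hΦ.finite_critical).2 fun t ht => ?_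
    obtain rfl | hts := eq_or_ne (Real.sin s₀ ^ 2) t
    · exact (hasDerivAt_sin_sq s₀).eventually_ne
        (two_mul_sin_mul_cos_ne_zero (mem_Ioo_of_not_transversal h0 h1 ht.1 ht.2))
    · exact nhdsWithin_le_nhds ((hasDerivAt_sin_sq s₀).continuousAt.eventually_ne hts)
  filter_upwards [hne] with s hs
  by_contra hcrit
  exact hs _ ⟨sin_sq_mem_Icc s, hcrit⟩ rfl

-- The derivative of `sin²` vanishes only where `sin²` is `0` or `1`, away from critical times.
lemma isRegularFamily (hΦ : IsGoodFamily g Φ) (h0 : Transversal (Φ 0) g)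
    (h1 : Transversal (Φ 1) g) : IsRegularFamily g fun s => Φ (Real.sin s ^ 2) where
  smooth := by
    have hsin : ContMDiff 𝓘(ℝ, ℝ) 𝓘(ℝ, ℝ) ∞ fun s : ℝ => Real.sin s ^ 2 :=
      (Real.contDiff_sin.pow 2).contMDiff
    exact hΦ.smooth.comp_contMDiff ((hsin.comp contMDiff_fst).prodMk contMDiff_snd)
      fun z => ⟨sin_sq_mem_Icc z.1, mem_univ z.2⟩
  embedding s := hΦ.embedding _ (sin_sq_mem_Icc s)
  link s := hΦ.link _ (sin_sq_mem_Icc s)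
  transversal s p q hpq := by
    by_cases htrans : Transversal (Φ (Real.sin s ^ 2)) g
    · rw [sup_assoc, htrans p q hpq, sup_top_eq]
    · rw [hΦ.span_deriv_sin_sq (mem_Ioo_of_not_transversal h0 h1 (sin_sq_mem_Icc s) htrans)]
      exact hΦ.transversal _ (sin_sq_mem_Icc s) p q hpq
  eventually_transversal := hΦ.eventually_transversal_sin_sq h0 h1
  model s := hΦ.model _ (sin_sq_mem_Icc s)

end IsGoodFamily

lemma IsGoodFamily.natCast_card_eq (hΦ : IsGoodFamily g Φ) (hg : IsSphereEmbedding g)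
    (h0 : Transversal (Φ 0) g) (h1 : Transversal (Φ 1) g) {m n : ℕ} {K : Fin m → Set E3}
    {L : Fin n → Set E3} (hK : ∀ i, IsKnot (K i)) (hL : ∀ i, IsKnot (L i))
    (hKd : Pairwise (Function.onFun Disjoint K)) (hLd : Pairwise (Function.onFun Disjoint L))
    (hK0 : range (Φ 0) ∩ range g = ⋃ i, K i) (hL1 : range (Φ 1) ∩ range g = ⋃ i, L i) :
    (m : ZMod 2) = n := by
  have hm := h0.hasComponentParity (hΦ.embedding 0 (by simp)) hK hKd hK0
  have hn := h1.hasComponentParity (hΦ.embedding 1 (by simp)) hL hLd hL1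
  exact (hΦ.isRegularFamily h0 h1).hasComponentParity_unique hg (s₀ := 0) (s₁ := Real.pi / 2)
    (by simpa using hm) (by simpa using hn)

lemma transversal_of_disjoint_range {f : S2 → E3} (h : Disjoint (range f) (range g)) :
    Transversal f g := fun p q hpq =>
  (h.notMem_of_mem_left (mem_range_self p) ⟨q, hpq.symm⟩).elim

end Reparametrization

end Bubbles

theorem theoremT_general (f g : Bubbles.S2 → Bubbles.E3) (hg : Bubbles.IsSphereEmbedding g)
    (htrans : Bubbles.Transversal f g) {n : ℕ} (hn : Odd n) {K : Fin n → Set Bubbles.E3}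
    (hK : ∀ i, Bubbles.IsKnot (K i)) (hdisj : Pairwise (Function.onFun Disjoint K))
    (hcircles : Set.range f ∩ Set.range g = ⋃ i, K i) :
    ¬ ∃ Φ : ℝ → Bubbles.S2 → Bubbles.E3,
        Bubbles.IsGoodFamily g Φ ∧ Φ 0 = f ∧ Disjoint (Set.range (Φ 1)) (Set.range g) := by
  rintro ⟨Φ, hΦ, rfl, hsep⟩
  have hparity := hΦ.natCast_card_eq hg htrans (Bubbles.transversal_of_disjoint_range hsep)
    (n := 0) (L := fun _ => ∅) hK (fun i => i.elim0) hdisj (fun i => i.elim0) hcircles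
    (by simpa using hsep.inter_eq)
  rw [(ZMod.natCast_eq_one_iff_odd).2 hn] at hparity
  exact one_ne_zero (hparity.trans Nat.cast_zero)

theorem theoremT (f g : Bubbles.S2 → Bubbles.E3)
    (hf : Bubbles.IsSphereEmbedding f) (hg : Bubbles.IsSphereEmbedding g)
    (htrans : Bubbles.Transversal f g)
    (hcircle : Bubbles.IsKnot (Set.range f ∩ Set.range g)) :
    ¬ ∃ Φ : ℝ → Bubbles.S2 → Bubbles.E3,
        Bubbles.IsGoodFamily g Φ ∧ Φ 0 = f ∧ Disjoint (Set.range (Φ 1)) (Set.range g) :=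
  theoremT_general f g hg htrans odd_one (K := fun _ => Set.range f ∩ Set.range g)
    (fun _ => hcircle) Subsingleton.pairwise (Set.iUnion_const _).symm
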